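/- Let $d\ge 1$, let $N\ge 0$ be an integer and let $\mathcal H=(h_j)_{j\ge 0}$ be a sequence of positive integers. **Shells and cells.** Let $\mathbb B(x,r)=\{y\in\mathbb Z^d:\|y-x\|<r\}$ (euclidean norm), $\mathbb A(r,R)=\mathbb B(0,R)\setminus\mathbb B(0,r)$, and $\partial\Lambda$ the set of sites of $\mathbb Z^d\setminus\Lambda$ with a nearest neighbour in $\Lambda$. Put $r_0=0$ and $r_{j+1}=r_j+h_j+h_{j+1}$. Let $\mathcal S_0=\mathbb B(0,h_0)$, $\Sigma_0=\{0\}$ and, for $j\ge 1$, $\mathcal S_j=\mathbb A(r_j-h_j,r_j+h_j)$, $\Sigma_j=\partial\mathbb B(0,r_j)$. For $z\in\Sigma_j$ the cell $\mathcal C(z)$ is the set of $x\in\mathcal S_j$ of the form $x=\lambda y$ with $\lambda\ge 0$, $y\in\mathbb R^d$, $\|y-z\|<h_j/2$. **Internal DLA.** For independent simple random walks $W_1,\dots,W_N$ on $\mathbb Z^d$ started at $0$, let $A(0)=\emptyset$ and $A(i)=A(i-1)\cup\{W_i(\tau_i)\}$ with $\tau_i=\inf\{t\ge 0: W_i(t)\notin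 A(i-1)\}$. **$\mathcal H$-flashing process.** Let $S_1,\dots,S_N$ be simple random walks on $\mathbb Z^d$ started at $0$. For $1\le i\le N$ and $j\ge 0$ let $X_{i,j},Y_{i,j}$ be Bernoulli variables with $P(X_{i,j}=1)=h_j^{-d}$, $P(Y_{i,0}=1)=1$ and $P(Y_{i,j}=1)=\frac12$ for $j\ge 1$, and let $R_{i,j}$ have density $\rho\mapsto d\rho^{d-1}/h_j^d$ on $[0,h_j]$; all walks and all these variables are independent. Let $H_{i,j}$ be the hitting time of $\Sigma_j$ by $S_i$ and $z_{i,j}=S_i(H_{i,j})$. Let $\sigma_{i,j}$ be the first time $t\ge H_{i,j}$ such that - no condition is imposed, i.e. $\sigma_{i,j}=H_{i,j}$, if $X_{i,j}=1$; - $S_i(t)\notin\mathbb B\big(z_{i,j},\min(R_{i,j},\,r_j+h_j-\|z_{i,j}\|)\big)$, if $X_{i,j}=0$ and $Y_{i,j}=1$; - $S_i(t)\notin\mathbb A(r_j-R_{i,j},r_j+R_{i,j})$, if $X_{i,j}=0$ and $Y_{i,j}=0$. The time $\sigma_{i,j}$ is a flashing time of explorer $i$ if $S_i(\sigma_{i,j})\in\mathcal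 C(z_{i,j})$. Let $A^*(0)=\emptyset$ and $A^*(i)=A^*(i-1)\cup\{S_i(\tau_i^*)\}$, where $\tau_i^*$ is the first flashing time of explorer $i$ at which $S_i$ is outside $A^*(i-1)$. **Statement.** There is a coupling of the two processes, that is, a probability space carrying walks $W_1,\dots,W_N$ with internal DLA cluster $A(N)$, and walks $S_1,\dots,S_N$ and variables $X_{i,j},Y_{i,j},R_{i,j}$ with flashing cluster $A^*(N)$ (each family with the law above), together with random times $T(i)\le T^*(i)=\tau_i^*<\infty$, $1\le i\le N$, such that almost surely $$A(N)=\bigcup_{i=1}^N\{S_i(T(i))\},\qquad A^*(N)=\bigcup_{i=1}^N\{S_i(T^*(i))\},$$ and under this coupling, almost surely, for every $k\ge 1$: - if $A^*(N)\subset\bigcup_{j<k}\mathcal S_j$, then $A(N)\subset\bigcup_{j<k}\mathcal S_j$; - if $\bigcup_{j<k}\mathcal S_j\subset A^*(N)$, then $\bigcup_{j<k}\mathcal S_j\subset A(N)$. -/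

import Mathlib

open MeasureTheory ProbabilityTheory
open scoped ENNReal

namespace FlashingDLA

noncomputable section

/-! ### The lattice -/

/-- The lattice `ℤ^d`. -/
abbrev Lattice (d : ℕ) : Type := Fin d → ℤ

/-- The embedding of `ℤ^d` in `ℝ^d` with its euclidean norm. -/
def toEuclid {d : ℕ} (x : Lattice d) : EuclideanSpace ℝ (Fin d) :=
  WithLp.toLp 2 (fun i => (x i : ℝ))

/-- Nearest neighbours: `‖z - z'‖ = 1`. -/
def Neighbor {d : ℕ} (z z' : Lattice d) : Prop :=
  ‖toEuclid z - toEuclid z'‖ = 1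

/-- The lattice sites of the open euclidean ball of centre `x` and radius `r`. -/
def latticeBall {d : ℕ} (x : Lattice d) (r : ℝ) : Set (Lattice d) :=
  {y | ‖toEuclid y - toEuclid x‖ < r}

/-- The lattice annulus `𝔹(0,R) \ 𝔹(0,r)`. -/
def latticeAnnulus (d : ℕ) (r R : ℝ) : Set (Lattice d) :=
  latticeBall 0 R \ latticeBall 0 r

/-- The outer boundary of a set of sites. -/
def outerBoundary {d : ℕ} (Λ : Set (Lattice d)) : Set (Lattice d) :=
  {z | z ∉ Λ ∧ ∃ z' ∈ Λ, Neighbor z' z}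

/-! ### Shells and cells -/

/-- The radii `r_j`, with `r_1 = h_0 + h_1` and `r_{j+1} - h_{j+1} = r_j + h_j`.
The convention `r_0 = 0` is compatible with both. -/
def shellRadius (h : ℕ → ℕ) : ℕ → ℝ
  | 0 => 0
  | j + 1 => shellRadius h j + h j + h (j + 1)

/-- The shells: `S_0 = 𝔹(0,h_0)` and `S_j = 𝔸(r_j - h_j, r_j + h_j)` for `j ≥ 1`. -/
def shell (d : ℕ) (h : ℕ → ℕ) (j : ℕ) : Set (Lattice d) :=
  if j = 0 then latticeBall 0 (h 0)
  else latticeAnnulus d (shellRadius h j - h j) (shellRadius h j + h j)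

/-- `Σ_0 = {0}` and `Σ_j = ∂𝔹(0,r_j)` for `j ≥ 1`. -/
def midSphere (d : ℕ) (h : ℕ → ℕ) (j : ℕ) : Set (Lattice d) :=
  if j = 0 then {0} else outerBoundary (latticeBall 0 (shellRadius h j))

/-- The cell of the shell `S_j` centred at `z`: the sites of `S_j` in the cone of base
`B(z, h_j / 2)`. -/
def cell {d : ℕ} (h : ℕ → ℕ) (j : ℕ) (z : Lattice d) : Set (Lattice d) :=
  {x | x ∈ shell d h j ∧ ∃ c : ℝ, 0 ≤ c ∧
    ∃ y ∈ Metric.ball (toEuclid z) ((h j : ℝ) / 2), toEuclid x = c • y}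

/-! ### Hitting times and flashing times of one trajectory -/

/-- The hitting time of `Λ`, equal to `⊤` when `Λ` is never hit. -/
def hitTime {d : ℕ} (Λ : Set (Lattice d)) (S : ℕ → Lattice d) : ℕ∞ :=
  ⨅ (t : ℕ) (_ : S t ∈ Λ), (t : ℕ∞)

/-- The stopping time `σ` of shell `j`, for a trajectory `S` started at `S 0 ∈ Σ_j`, with
flags `x`, `y` and radius `ρ`. -/
def localTime {d : ℕ} (h : ℕ → ℕ) (j : ℕ) (x y : Bool) (ρ : ℝ) (S : ℕ → Lattice d) : ℕ∞ :=
  if x = true then 0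
  else if y = true then
    hitTime (latticeBall (S 0) (min ρ (shellRadius h j + h j - ‖toEuclid (S 0)‖)))ᶜ S
  else hitTime (latticeAnnulus d (shellRadius h j - ρ) (shellRadius h j + ρ))ᶜ S

/-- The time `H_j` at which `S` first hits `Σ_j`. -/
def midTime {d : ℕ} (h : ℕ → ℕ) (j : ℕ) (S : ℕ → Lattice d) : ℕ∞ :=
  hitTime (midSphere d h j) S

/-- The stopping time `σ_j = H_j + σ(S ∘ θ_{H_j})` (equal to `⊤` if `H_j = ⊤`). -/
def stopTime {d : ℕ} (h : ℕ → ℕ) (j : ℕ) (x y : Bool) (ρ : ℝ) (S : ℕ → Lattice d) : ℕ∞ :=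
  midTime h j S + localTime h j x y ρ (fun t => S ((midTime h j S).toNat + t))

/-- `t` is the flashing time of `S` in shell `j`: `σ_j = t`, and `S t` lies in the cell centred
at `S (H_j)`. -/
def IsFlashAt {d : ℕ} (h : ℕ → ℕ) (j : ℕ) (x y : Bool) (ρ : ℝ) (S : ℕ → Lattice d)
    (t : ℕ) : Prop :=
  stopTime h j x y ρ S = (t : ℕ∞) ∧ S t ∈ cell h j (S (midTime h j S).toNat)

/-- The first flashing time at which the trajectory `S`, with flags `x j`, `y j` and radii `ρ j`,
is outside `A` (equal to `⊤` if there is none). -/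
def flashSettleTime {d : ℕ} (h : ℕ → ℕ) (x y : ℕ → Bool) (ρ : ℕ → ℝ) (S : ℕ → Lattice d)
    (A : Set (Lattice d)) : ℕ∞ :=
  ⨅ (t : ℕ) (_ : (∃ j, IsFlashAt h j (x j) (y j) (ρ j) S t) ∧ S t ∉ A), (t : ℕ∞)

/-! ### The clusters -/

/-- The clusters `A(0) = ∅`, `A(n+1) = A(n) ∪ {S_{n+1}(τ_{n+1})}`, where the settling time of an
explorer is the function `τ` of the cluster that it finds. The explorers `1, …, N` are indexed
by `Fin N`, so that the explorer `n + 1` has index `n`; an explorer with settling time `⊤` does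
not settle. -/
def cluster {d N : ℕ} (S : Fin N → ℕ → Lattice d) (τ : Fin N → Set (Lattice d) → ℕ∞) :
    ℕ → Set (Lattice d)
  | 0 => ∅
  | n + 1 => cluster S τ n ∪
      {z | ∃ hn : n < N, ∃ t : ℕ, τ ⟨n, hn⟩ (cluster S τ n) = (t : ℕ∞) ∧ S ⟨n, hn⟩ t = z}

/-- The internal DLA cluster `A(n)`: each explorer settles when it first leaves the cluster. -/
def idlaCluster {d N : ℕ} (S : Fin N → ℕ → Lattice d) (n : ℕ) : Set (Lattice d) :=
  cluster S (fun i A => hitTime Aᶜ (S i)) n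

/-- The flashing cluster `A*(n)`. -/
def flashCluster {d N : ℕ} (h : ℕ → ℕ) (S : Fin N → ℕ → Lattice d) (x y : Fin N → ℕ → Bool)
    (ρ : Fin N → ℕ → ℝ) (n : ℕ) : Set (Lattice d) :=
  cluster S (fun i A => flashSettleTime h (x i) (y i) (ρ i) (S i) A) n

/-- The settling time `τ*_i` of explorer `i` in the flashing process: its first flashing time
outside the cluster formed by the explorers before it. -/
def flashTime {d N : ℕ} (h : ℕ → ℕ) (S : Fin N → ℕ → Lattice d) (x y : Fin N → ℕ → Bool)
    (ρ : Fin N → ℕ → ℝ) (i : Fin N) : ℕ∞ :=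
  flashSettleTime h (x i) (y i) (ρ i) (S i) (flashCluster h S x y ρ i)

/-! ### Laws -/

/-- The law of a step of the simple random walk: uniform on the `2d` unit vectors. -/
def stepLaw (d : ℕ) : Measure (Lattice d) :=
  ∑ i : Fin d, (((2 * d : ℕ) : ℝ≥0∞)⁻¹ • Measure.dirac (Pi.single i (1 : ℤ)) +
    ((2 * d : ℕ) : ℝ≥0∞)⁻¹ • Measure.dirac (Pi.single i (-1 : ℤ)))

/-- The Bernoulli law of parameter `p`, with `true` for the value `1`. -/
def bernoulliLaw (p : ℝ) : Measure Bool :=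
  ENNReal.ofReal p • Measure.dirac true + ENNReal.ofReal (1 - p) • Measure.dirac false

/-- The law on `[0, m]` of density `ρ ↦ d ρ^(d-1) / m^d`. -/
def radiusLaw (d m : ℕ) : Measure ℝ :=
  (volume.restrict (Set.Icc (0 : ℝ) m)).withDensity
    (fun ρ => ENNReal.ofReal (d * ρ ^ (d - 1) / (m : ℝ) ^ d))

/-- The `S_i` are independent simple random walks on `ℤ^d` started at `0`. -/
structure IsWalkFamily {d N : ℕ} {Ω : Type*} [MeasurableSpace Ω] (P : Measure Ω)
    (S : Fin N → ℕ → Ω → Lattice d) : Prop where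
  measurable : ∀ i t, Measurable (S i t)
  start : ∀ i ω, S i 0 ω = 0
  indep : iIndepFun (fun (p : Fin N × ℕ) ω => S p.1 (p.2 + 1) ω - S p.1 p.2 ω) P
  law : ∀ i t, P.map (fun ω => S i (t + 1) ω - S i t ω) = stepLaw d

/-- The randomness of the flashing process: the `S_i` are simple random walks on `ℤ^d` started
at `0`, the flags `X_{i,j}`, `Y_{i,j}` are Bernoulli variables with
`P(X_{i,j} = 1) = 1 / h_j^d`, `P(Y_{i,0} = 1) = 1` and `P(Y_{i,j} = 1) = 1 / 2` for `j ≥ 1`, the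
radius `R_{i,j}` has density `d ρ^(d-1) / h_j^d` on `[0, h_j]`, and all the steps, flags and
radii are independent. (The `j`-th step of walk `i` is grouped with `X_{i,j}`, `Y_{i,j}`,
`R_{i,j}`; the quadruples are independent, and each has a product law.) -/
structure IsFlashingFamily {d N : ℕ} {Ω : Type*} [MeasurableSpace Ω] (h : ℕ → ℕ) (P : Measure Ω)
    (S : Fin N → ℕ → Ω → Lattice d) (X Y : Fin N → ℕ → Ω → Bool)
    (R : Fin N → ℕ → Ω → ℝ) : Prop where
  measurable_walk : ∀ i t, Measurable (S i t)
  measurable_flagX : ∀ i j, Measurable (X i j)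
  measurable_flagY : ∀ i j, Measurable (Y i j)
  measurable_radius : ∀ i j, Measurable (R i j)
  start : ∀ i ω, S i 0 ω = 0
  indep : iIndepFun (fun (p : Fin N × ℕ) ω =>
    (S p.1 (p.2 + 1) ω - S p.1 p.2 ω, X p.1 p.2 ω, Y p.1 p.2 ω, R p.1 p.2 ω)) P
  law : ∀ i j, P.map (fun ω => (S i (j + 1) ω - S i j ω, X i j ω, Y i j ω, R i j ω)) =
    (stepLaw d).prod ((bernoulliLaw (1 / (h j : ℝ) ^ d)).prod
      ((bernoulliLaw (if j = 0 then 1 else 1 / 2)).prod (radiusLaw d (h j))))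

end

end FlashingDLA

open FlashingDLA

/-! The internal DLA is read along the trajectories of the flashing explorers. Walk `n` starts with
explorer `n` at the origin. When two released explorers `i < j` share a site, the walk continues
with the next step of `j` if `i` is flashing there, and with the next step of `i` otherwise. When no
two share a site, the walk has left the cluster and settles (`RunInvariant`). Walk steps never
assigned in this way are taken from an independent reserve of extra steps.

No explorer is pushed beyond its flashing settling time (`run_time_le`). If `i` flashes at `z` no
later than its settling time, then `z` lies in the cluster left by `i`, so no `j > i` settles at `z`
(`flashTime_priority`); and every settling time is a flashing time. Hence neither case of the rule
moves an explorer that has reached its settling time. The total time is then bounded, the run ends,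
and the explorers stopped at times `T ≤ T*` occupy the internal DLA cluster, one per site
(`finalTime_spec`).

The assigned steps have the right law because the rule decides which step to use before looking at
it. Assigning one more step amounts to exchanging an unseen explorer step with a reserve step
(`envOutput_succ`). On each event fixing this choice, the exchange preserves both the event and the
i.i.d. law (`map_eq_map_of_resampling`, `map_envFinalOutput`).

For the comparison, an explorer that flashes in shell `j` has not yet left the first `j + 1` shells
(`IsFlashAt.norm_lt`). So an explorer settled within the first `k` shells was already there at time
`T`. This gives the outer inclusion, and the inner one follows by counting (`shells_comparison`).

Flashing settling times are a.s. finite: each shell has flags that force a flash with probability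
bounded below, so by Borel–Cantelli this happens in infinitely many shells, hence beyond any finite
cluster. -/

namespace FlashingDLA

/-! ### First hitting times -/

/-- `k` is the first time at which `S` lies in `Λ`. -/
def FirstHit {α : Type*} (Λ : Set α) (S : ℕ → α) (k : ℕ) : Prop :=
  S k ∈ Λ ∧ ∀ l < k, S l ∉ Λ

lemma exists_firstHit {α : Type*} {Λ : Set α} {S : ℕ → α} {t : ℕ} (ht : S t ∈ Λ) :
    ∃ k ≤ t, FirstHit Λ S k := by
  classical
  have hex : ∃ t, S t ∈ Λ := ⟨t, ht⟩
  exact ⟨Nat.find hex, Nat.find_min' hex ht, Nat.find_spec hex, fun l hl => Nat.find_min hex hl⟩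

lemma iInf_coe_eq_coe_iff (p : ℕ → Prop) (k : ℕ) :
    (⨅ (t : ℕ) (_ : p t), (t : ℕ∞)) = k ↔ p k ∧ ∀ l < k, ¬ p l := by
  have key : ∀ m : ℕ, p m → (∀ l < m, ¬ p l) → (⨅ (t : ℕ) (_ : p t), (t : ℕ∞)) = m := by
    intro m hm hl
    refine le_antisymm (iInf₂_le m hm) (le_iInf₂ fun t ht => ?_)
    exact_mod_cast not_lt.1 fun hlt => hl t hlt ht
  constructor
  · intro h
    obtain ⟨t, ht⟩ : ∃ t, p t := by
      by_contra! hne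
      simp [hne] at h
    obtain ⟨m, -, hm, hl⟩ := exists_firstHit (Λ := {t | p t}) (S := id) ht
    have := key m hm hl
    rw [h] at this
    have hkm : k = m := by exact_mod_cast this
    exact hkm ▸ ⟨hm, hl⟩
  · exact fun h => key k h.1 h.2

lemma iInf_coe_ne_top_iff (p : ℕ → Prop) :
    (⨅ (t : ℕ) (_ : p t), (t : ℕ∞)) ≠ ⊤ ↔ ∃ t, p t := by
  simp [iInf_eq_top]

lemma hitTime_eq_coe_iff {d : ℕ} {Λ : Set (Lattice d)} {S : ℕ → Lattice d} {k : ℕ} :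
    hitTime Λ S = k ↔ FirstHit Λ S k :=
  iInf_coe_eq_coe_iff _ _

/-! ### Lattice geometry -/

lemma toEuclid_zero {d : ℕ} : toEuclid (0 : Lattice d) = 0 := by
  ext i; simp [toEuclid]

lemma mem_latticeBall_zero {d : ℕ} {x : Lattice d} {r : ℝ} :
    x ∈ latticeBall 0 r ↔ ‖toEuclid x‖ < r := by
  simp [latticeBall, toEuclid_zero]

lemma mem_latticeAnnulus {d : ℕ} {x : Lattice d} {r R : ℝ} :
    x ∈ latticeAnnulus d r R ↔ r ≤ ‖toEuclid x‖ ∧ ‖toEuclid x‖ < R := by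
  simp [latticeAnnulus, mem_latticeBall_zero, and_comm]

lemma Neighbor.norm_lt {d : ℕ} {x y : Lattice d} (h : Neighbor x y) (z : EuclideanSpace ℝ (Fin d))
    {r : ℝ} (hx : ‖toEuclid x - z‖ < r) : ‖toEuclid y - z‖ < r + 1 := by
  have h1 : ‖toEuclid y - toEuclid x‖ = 1 := by rw [norm_sub_rev]; exact h
  calc ‖toEuclid y - z‖ = ‖(toEuclid y - toEuclid x) + (toEuclid x - z)‖ := by congr 1; abel
    _ ≤ ‖toEuclid y - toEuclid x‖ + ‖toEuclid x - z‖ := norm_add_le _ _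
    _ < r + 1 := by linarith

/-- A nearest neighbour trajectory. -/
def IsPath {d : ℕ} (S : ℕ → Lattice d) : Prop :=
  S 0 = 0 ∧ ∀ t, Neighbor (S t) (S (t + 1))

/-- A trajectory which leaves every ball. -/
def IsUnboundedPath {d : ℕ} (S : ℕ → Lattice d) : Prop :=
  ∀ K : ℝ, ∃ t, K ≤ ‖toEuclid (S t)‖

lemma IsUnboundedPath.shift {d : ℕ} {S : ℕ → Lattice d} (hS : IsUnboundedPath S) (H : ℕ) (K : ℝ) :
    ∃ t, K ≤ ‖toEuclid (S (H + t))‖ := by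
  -- The sum plus one exceeds every norm before time `H`, which forces `H ≤ t`.
  obtain ⟨t, ht⟩ := hS (max K (∑ s ∈ Finset.range H, ‖toEuclid (S s)‖ + 1))
  have hHt : H ≤ t := by
    by_contra! hlt
    have := Finset.single_le_sum (f := fun s => ‖toEuclid (S s)‖)
      (fun s _ => norm_nonneg _) (Finset.mem_range.2 hlt)
    have h2 := (le_max_right _ _).trans ht
    linarith
  refine ⟨t - H, ?_⟩
  rw [Nat.add_sub_cancel' hHt]
  exact (le_max_left _ _).trans ht

/-! ### Shells -/

section Shells

variable {d : ℕ} {h : ℕ → ℕ}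

lemma shellRadius_succ_sub (j : ℕ) :
    shellRadius h (j + 1) - h (j + 1) = shellRadius h j + h j := by
  simp [shellRadius]

lemma shellRadius_nonneg (j : ℕ) : 0 ≤ shellRadius h j := by
  induction j with
  | zero => simp [shellRadius]
  | succ j ih => simp only [shellRadius]; positivity

lemma outerRadius_mono : Monotone fun j => shellRadius h j + h j := by
  refine monotone_nat_of_le_succ fun j => ?_
  simp only [shellRadius]
  have : (0 : ℝ) ≤ h (j + 1) := by positivity
  linarith

lemma outerRadius_le_innerRadius {j k : ℕ} (hjk : j < k) :
    shellRadius h j + h j ≤ shellRadius h k - h k := by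
  obtain ⟨k, rfl⟩ : ∃ k', k = k' + 1 := ⟨k - 1, by omega⟩
  rw [shellRadius_succ_sub]
  exact outerRadius_mono (by omega)

lemma le_outerRadius (hh : ∀ j, 0 < h j) (j : ℕ) : (j : ℝ) ≤ shellRadius h j + h j := by
  induction j with
  | zero => simp [shellRadius]
  | succ j ih =>
    have : (1 : ℝ) ≤ h (j + 1) := by exact_mod_cast hh (j + 1)
    simp only [shellRadius]
    push_cast
    linarith

lemma norm_lt_of_mem_shell {j : ℕ} {x : Lattice d} (hx : x ∈ shell d h j) :
    ‖toEuclid x‖ < shellRadius h j + h j := by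
  unfold shell at hx
  split_ifs at hx with hj
  · subst hj; simpa [shellRadius, mem_latticeBall_zero] using hx
  · exact (mem_latticeAnnulus.1 hx).2

lemma le_norm_of_mem_shell {j : ℕ} {x : Lattice d} (hx : x ∈ shell d h j) :
    shellRadius h j - h j ≤ ‖toEuclid x‖ := by
  unfold shell at hx
  split_ifs at hx with hj
  · subst hj
    have : (0 : ℝ) ≤ h 0 := by positivity
    have h2 := norm_nonneg (toEuclid x)
    simp only [shellRadius]; linarith
  · exact (mem_latticeAnnulus.1 hx).1

lemma mem_shell_of_pos {j : ℕ} (hj : j ≠ 0) {x : Lattice d} :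
    x ∈ shell d h j ↔ shellRadius h j - h j ≤ ‖toEuclid x‖ ∧
      ‖toEuclid x‖ < shellRadius h j + h j := by
  rw [shell, if_neg hj, mem_latticeAnnulus]

/-- The inner radius of each shell is the outer radius of the preceding one, so the shells tile a
ball without gap. -/
lemma iUnion_shell (k : ℕ) :
    (⋃ j < k + 1, shell d h j) = latticeBall 0 (shellRadius h k + h k) := by
  ext x
  simp only [Set.mem_iUnion, exists_prop, mem_latticeBall_zero]
  constructor
  · rintro ⟨j, hj, hx⟩
    exact (norm_lt_of_mem_shell hx).trans_le (outerRadius_mono (by omega))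
  · intro hx
    induction k with
    | zero => exact ⟨0, by omega, by simpa [shell, mem_latticeBall_zero, shellRadius] using hx⟩
    | succ k ih =>
      by_cases hk : ‖toEuclid x‖ < shellRadius h k + h k
      · obtain ⟨j, hj, hx⟩ := ih hk
        exact ⟨j, by omega, hx⟩
      · refine ⟨k + 1, by omega, (mem_shell_of_pos (by omega)).2 ⟨?_, hx⟩⟩
        rw [shellRadius_succ_sub]
        exact not_lt.1 hk

lemma lt_of_mem_shell_of_mem_iUnion {j k : ℕ} {x : Lattice d} (hx : x ∈ shell d h j)
    (hxk : x ∈ ⋃ j < k, shell d h j) : j < k := by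
  by_contra! hkj
  simp only [Set.mem_iUnion, exists_prop] at hxk
  obtain ⟨i, hi, hxi⟩ := hxk
  have h1 := norm_lt_of_mem_shell hxi
  have h2 := le_norm_of_mem_shell hx
  have h3 := outerRadius_le_innerRadius (h := h) (hi.trans_le hkj)
  linarith

end Shells

/-! ### Flashing times -/

section Flashing

variable {d : ℕ} {h : ℕ → ℕ}

/-- The set whose first visit after `H_j` defines the stopping time of shell `j`, when the
explorer is at `z` at time `H_j`. -/
def localTarget (h : ℕ → ℕ) (j : ℕ) (x y : Bool) (ρ : ℝ) (z : Lattice d) : Set (Lattice d) :=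
  {w | if x = true then True
    else if y = true then
      min ρ (shellRadius h j + h j - ‖toEuclid z‖) ≤ ‖toEuclid w - toEuclid z‖
    else ‖toEuclid w‖ < shellRadius h j - ρ ∨ shellRadius h j + ρ ≤ ‖toEuclid w‖}

lemma localTime_eq_coe_iff {j : ℕ} {x y : Bool} {ρ : ℝ} {S : ℕ → Lattice d} {k : ℕ} :
    localTime h j x y ρ S = k ↔ FirstHit (localTarget h j x y ρ (S 0)) S k := by
  unfold localTime
  split_ifs with hx hy
  · simp only [FirstHit, localTarget, if_pos hx, Set.ofPred_true, Set.mem_univ, not_true_eq_false,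
      true_and]
    constructor
    · intro h0 l hl
      have : k = 0 := by exact_mod_cast h0.symm
      omega
    · intro h0
      have : k = 0 := by
        by_contra hk
        exact h0 0 (by omega)
      simp [this]
  · rw [hitTime_eq_coe_iff]
    have : (latticeBall (S 0) (min ρ (shellRadius h j + h j - ‖toEuclid (S 0)‖)))ᶜ =
        localTarget h j x y ρ (S 0) := by
      ext w
      simp only [localTarget, if_neg hx, if_pos hy, latticeBall, Set.mem_compl_iff,
        Set.mem_ofPred_eq, not_lt]
    rw [this]
  · rw [hitTime_eq_coe_iff]
    have : (latticeAnnulus d (shellRadius h j - ρ) (shellRadius h j + ρ))ᶜ =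
        localTarget h j x y ρ (S 0) := by
      ext w
      simp only [localTarget, if_neg hx, if_neg hy, Set.mem_compl_iff, mem_latticeAnnulus,
        Set.mem_ofPred_eq, not_and_or, not_le, not_lt]
    rw [this]

/-- Trades arithmetic in `ℕ∞` for two successive first hits, a form from which locality and
measurability can be read off. -/
lemma isFlashAt_iff {j : ℕ} {x y : Bool} {ρ : ℝ} {S : ℕ → Lattice d} {t : ℕ} :
    IsFlashAt h j x y ρ S t ↔ ∃ H ≤ t, FirstHit (midSphere d h j) S H ∧
      FirstHit (localTarget h j x y ρ (S H)) (fun s => S (H + s)) (t - H) ∧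
      S t ∈ cell h j (S H) := by
  constructor
  · rintro ⟨hst, hcell⟩
    unfold stopTime at hst
    obtain ⟨H, hH⟩ : ∃ H : ℕ, midTime h j S = H := by
      refine ⟨(midTime h j S).toNat, (ENat.natCast_toNat ?_).symm⟩
      intro htop
      simp [htop] at hst
    rw [hH] at hst hcell
    simp only [ENat.toNat_natCast] at hst hcell
    obtain ⟨k, hk⟩ : ∃ k : ℕ, localTime h j x y ρ (fun t => S (H + t)) = k := by
      refine ⟨_, (ENat.natCast_toNat ?_).symm⟩
      intro htop
      simp [htop] at hst
    rw [hk] at hst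
    have hkt : H + k = t := by exact_mod_cast hst
    refine ⟨H, by omega, hitTime_eq_coe_iff.1 hH, ?_, hcell⟩
    rw [localTime_eq_coe_iff] at hk
    rwa [show t - H = k by omega]
  · rintro ⟨H, hHt, hmid, hloc, hcell⟩
    have hH : midTime h j S = H := hitTime_eq_coe_iff.2 hmid
    have hk := (localTime_eq_coe_iff (h := h) (j := j) (x := x) (y := y) (ρ := ρ)
      (S := fun s => S (H + s)) (k := t - H)).2 (by simpa using hloc)
    unfold IsFlashAt stopTime
    rw [hH]
    simp only [ENat.toNat_natCast]
    rw [hk]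
    exact ⟨by exact_mod_cast Nat.add_sub_cancel' hHt, hcell⟩

/-- Whether `t` is a flashing time depends only on the trajectory up to time `t`. -/
lemma isFlashAt_congr {j : ℕ} {x y : Bool} {ρ : ℝ} {S S' : ℕ → Lattice d} {t : ℕ}
    (hS : ∀ s ≤ t, S s = S' s) : IsFlashAt h j x y ρ S t ↔ IsFlashAt h j x y ρ S' t := by
  have key : ∀ S S' : ℕ → Lattice d, (∀ s ≤ t, S s = S' s) → IsFlashAt h j x y ρ S t →
      IsFlashAt h j x y ρ S' t := by
    intro S S' hS
    rw [isFlashAt_iff, isFlashAt_iff]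
    rintro ⟨H, hHt, ⟨hm, hm'⟩, ⟨hl, hl'⟩, hc⟩
    refine ⟨H, hHt, ⟨hS H hHt ▸ hm, fun l hl => hS l (by omega) ▸ hm' l hl⟩, ⟨?_, fun l hl => ?_⟩, ?_⟩
    · rw [← hS H hHt]; dsimp only; rw [← hS (H + (t - H)) (by omega)]; exact hl
    · rw [← hS H hHt]; dsimp only; rw [← hS (H + l) (by omega)]; exact hl' l hl
    · rw [← hS H hHt, ← hS t le_rfl]; exact hc
  exact ⟨key S S' hS, key S' S fun s hs => (hS s hs).symm⟩

/-- A nearest neighbour path from the origin cannot leave a ball without visiting its outer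
boundary. For `j = 0` the hypothesis fails at time `0`. -/
lemma norm_lt_of_before_midSphere {j : ℕ} (hh : ∀ j, 0 < h j) {S : ℕ → Lattice d} (hS : IsPath S)
    {t : ℕ} (ht : ∀ l ≤ t, S l ∉ midSphere d h j) : ‖toEuclid (S t)‖ < shellRadius h j := by
  by_cases hj : j = 0
  · exact absurd (by simp [midSphere, hj, hS.1]) (ht 0 (Nat.zero_le _))
  · induction t with
    | zero =>
      rw [hS.1, toEuclid_zero, norm_zero]
      obtain ⟨j, rfl⟩ : ∃ k', j = k' + 1 := ⟨j - 1, by omega⟩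
      have h1 := shellRadius_nonneg (h := h) j
      have : (0 : ℝ) < h j := by exact_mod_cast hh j
      simp only [shellRadius]
      positivity
    | succ t ih =>
      have h1 := ih fun l hl => ht l (by omega)
      by_contra hlt
      refine ht (t + 1) le_rfl ?_
      rw [midSphere, if_neg hj]
      exact ⟨fun hmem => hlt (mem_latticeBall_zero.1 hmem), S t, mem_latticeBall_zero.2 h1, hS.2 t⟩

/-- Up to a flashing time in the shell `S_j`, an explorer stays in the first `j + 1` shells. -/
lemma IsFlashAt.norm_lt {j : ℕ} (hh : ∀ j, 0 < h j) {x y : Bool} {ρ : ℝ} (hρ : ρ ≤ h j)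
    {S : ℕ → Lattice d} (hS : IsPath S) {t : ℕ} (hf : IsFlashAt h j x y ρ S t) {s : ℕ}
    (hs : s ≤ t) : ‖toEuclid (S s)‖ < shellRadius h j + h j := by
  obtain ⟨H, hHt, hmid, hloc, hcell⟩ := isFlashAt_iff.1 hf
  have hhj : (0 : ℝ) < h j := by exact_mod_cast hh j
  rcases hs.eq_or_lt with rfl | hst
  · exact norm_lt_of_mem_shell hcell.1
  rcases lt_or_ge s H with hsH | hsH
  · have := norm_lt_of_before_midSphere hh hS fun l (hl : l ≤ s) => hmid.2 l (by omega)
    linarith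
  · have h1 := hloc.2 (s - H) (by omega)
    simp only [Nat.add_sub_cancel' hsH, localTarget, Set.mem_ofPred_eq] at h1
    split_ifs at h1 with hx hy
    · exact absurd trivial h1
    · rw [not_le] at h1
      -- The cap `r_j + h_j - ‖z‖` on the radius keeps the ball around `z` inside the outer sphere
      -- of the shell.
      have h2 := h1.trans_le (min_le_right _ _)
      have h3 := norm_le_norm_add_norm_sub' (toEuclid (S s)) (toEuclid (S H))
      linarith
    · rw [not_or, not_le] at h1
      linarith [h1.2]

/-- Flags which make an explorer flash in the shell `S_j`. -/
def GoodFlags (h : ℕ → ℕ) (j : ℕ) (x y : Bool) (ρ : ℝ) : Prop :=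
  x = true ∨ (y = true ∧ 4 ≤ h j ∧ ρ ≤ h j / 4)

lemma exists_firstHit_midSphere {j : ℕ} (hh : ∀ j, 0 < h j) {S : ℕ → Lattice d} (hS : IsPath S)
    (hub : IsUnboundedPath S) : ∃ H, FirstHit (midSphere d h j) S H := by
  by_contra! hne
  obtain ⟨t, ht⟩ := hub (shellRadius h j)
  refine (norm_lt_of_before_midSphere hh hS (j := j) (t := t) fun l _ hl => ?_).not_ge ht
  obtain ⟨k, -, hk⟩ := exists_firstHit hl
  exact hne k hk

lemma mem_cell_of_norm_sub_lt {j : ℕ} {x z : Lattice d} (hx : x ∈ shell d h j)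
    (hxz : ‖toEuclid x - toEuclid z‖ < h j / 2) : x ∈ cell h j z :=
  ⟨hx, 1, zero_le_one, toEuclid x, by rwa [Metric.mem_ball, dist_eq_norm], by simp⟩

/-- If `x` holds, the explorer stops on `Σ_j` at the centre of its own cell. Otherwise it leaves a
ball of radius at most `h_j / 4` with an overshoot of less than one step, and `h_j / 4 + 1 ≤ h_j /
2` since `h_j ≥ 4`; this keeps it in the cell. -/
lemma GoodFlags.exists_isFlashAt {j : ℕ} (hj : j ≠ 0) (hh : ∀ j, 0 < h j) {x y : Bool} {ρ : ℝ}
    (hg : GoodFlags h j x y ρ) {S : ℕ → Lattice d} (hS : IsPath S) (hub : IsUnboundedPath S) :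
    ∃ t, IsFlashAt h j x y ρ S t := by
  obtain ⟨H, hH⟩ := exists_firstHit_midSphere (j := j) hh hS hub
  have hhj : (1 : ℝ) ≤ h j := by exact_mod_cast hh j
  have hmem := hH.1
  rw [midSphere, if_neg hj] at hmem
  obtain ⟨hout, z', hz', hnb⟩ := hmem
  have hge : shellRadius h j ≤ ‖toEuclid (S H)‖ := by
    simpa [mem_latticeBall_zero] using hout
  have hlt : ‖toEuclid (S H)‖ < shellRadius h j + 1 := by
    simpa using hnb.norm_lt 0 (r := shellRadius h j) (by simpa [mem_latticeBall_zero] using hz')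
  by_cases hx : x = true
  · refine ⟨H, isFlashAt_iff.2 ⟨H, le_rfl, hH, ⟨by simp [localTarget, hx], by simp⟩, ?_⟩⟩
    refine mem_cell_of_norm_sub_lt ((mem_shell_of_pos hj).2 ⟨by linarith, by linarith⟩) ?_
    simp; exact hh j
  · obtain ⟨hy, h4, hρ⟩ := hg.resolve_left hx
    have h4' : (4 : ℝ) ≤ h j := by exact_mod_cast h4
    -- At such a norm the distance to `S H` is at least `ρ`, so the ball has been left.
    obtain ⟨t, ht⟩ := hub.shift H (ρ + ‖toEuclid (S H)‖)
    obtain ⟨k, -, hk⟩ := exists_firstHit (Λ := localTarget h j x y ρ (S H))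
      (S := fun s => S (H + s)) (t := t) (by
        simp only [localTarget, if_neg hx, if_pos hy, Set.mem_ofPred_eq]
        refine (min_le_left _ _).trans ?_
        have := norm_le_norm_add_norm_sub' (toEuclid (S (H + t))) (toEuclid (S H))
        linarith)
    have hclose : ‖toEuclid (S (H + k)) - toEuclid (S H)‖ < h j / 2 := by
      rcases Nat.eq_zero_or_pos k with rfl | hk0
      · simp; exact hh j
      · have h1 := hk.2 (k - 1) (by omega)
        simp only [localTarget, if_neg hx, if_pos hy, Set.mem_ofPred_eq, not_le] at h1
        have h2 := (hS.2 (H + (k - 1))).norm_lt _ (h1.trans_le (min_le_left _ _))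
        rw [show H + (k - 1) + 1 = H + k by omega] at h2
        linarith
    refine ⟨H + k, isFlashAt_iff.2 ⟨H, by omega, hH, by rwa [Nat.add_sub_cancel_left], ?_⟩⟩
    refine mem_cell_of_norm_sub_lt ((mem_shell_of_pos hj).2 ?_) hclose
    have h1 := norm_le_norm_add_norm_sub' (toEuclid (S (H + k))) (toEuclid (S H))
    have h2 := norm_le_norm_add_norm_sub' (toEuclid (S H)) (toEuclid (S (H + k)))
    rw [norm_sub_rev] at h2
    constructor <;> linarith

end Flashing

/-! ### Clusters -/

section Clusters

variable {d N : ℕ} {S : Fin N → ℕ → Lattice d} {τ : Fin N → Set (Lattice d) → ℕ∞}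

lemma cluster_mono : Monotone (cluster S τ) :=
  monotone_nat_of_le_succ fun _ => Set.subset_union_left

lemma cluster_finite (n : ℕ) : (cluster S τ n).Finite := by
  induction n with
  | zero => exact Set.finite_empty
  | succ n ih =>
    refine ih.union (Set.Subsingleton.finite ?_)
    rintro _ ⟨hn, t, ht, rfl⟩ _ ⟨hn', t', ht', rfl⟩
    have : t = t' := by exact_mod_cast ht.symm.trans ht'
    rw [this]

lemma cluster_succ_of_eq {n : ℕ} (hn : n < N) {t : ℕ} (ht : τ ⟨n, hn⟩ (cluster S τ n) = t) :
    cluster S τ (n + 1) = insert (S ⟨n, hn⟩ t) (cluster S τ n) := by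
  rw [Set.insert_eq, Set.union_comm, cluster]
  congr 1
  ext z
  constructor
  · rintro ⟨_, t', ht', rfl⟩
    have : t = t' := by exact_mod_cast ht.symm.trans ht'
    rw [this]; rfl
  · rintro rfl
    exact ⟨hn, t, ht, rfl⟩

lemma cluster_eq_image {T : Fin N → ℕ} (hT : ∀ i : Fin N, τ i (cluster S τ i) = T i) {n : ℕ}
    (hn : n ≤ N) : cluster S τ n = (fun i => S i (T i)) '' {i : Fin N | (i : ℕ) < n} := by
  induction n with
  | zero => simp [cluster]
  | succ n ih =>
    rw [cluster_succ_of_eq hn (hT ⟨n, hn⟩), ih (by omega)]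
    have : {i : Fin N | (i : ℕ) < n + 1} = insert ⟨n, hn⟩ {i : Fin N | (i : ℕ) < n} := by
      ext i
      simp only [Set.mem_insert_iff, Set.mem_ofPred_eq, Fin.ext_iff]
      omega
    rw [this, Set.image_insert_eq]

end Clusters

/-! ### Settling times of the flashing process -/

section FlashSettle

variable {d N : ℕ} {h : ℕ → ℕ} {S : Fin N → ℕ → Lattice d} {x y : Fin N → ℕ → Bool}
  {ρ : Fin N → ℕ → ℝ} {T : Fin N → ℕ}

/-- `t` is a flashing time of the trajectory `S`. -/
def IsFlash (h : ℕ → ℕ) (x y : ℕ → Bool) (ρ : ℕ → ℝ) (S : ℕ → Lattice d) (t : ℕ) : Prop :=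
  ∃ j, IsFlashAt h j (x j) (y j) (ρ j) S t

lemma isFlash_congr {x y : ℕ → Bool} {ρ : ℕ → ℝ} {S S' : ℕ → Lattice d} {t : ℕ}
    (hS : ∀ s ≤ t, S s = S' s) : IsFlash h x y ρ S t ↔ IsFlash h x y ρ S' t :=
  exists_congr fun _ => isFlashAt_congr hS

lemma flashTime_eq_coe_iff {i : Fin N} {t : ℕ} :
    flashTime h S x y ρ i = t ↔
      (IsFlash h (x i) (y i) (ρ i) (S i) t ∧ S i t ∉ flashCluster h S x y ρ i) ∧
        ∀ l < t, ¬ (IsFlash h (x i) (y i) (ρ i) (S i) l ∧ S i l ∉ flashCluster h S x y ρ i) :=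
  iInf_coe_eq_coe_iff _ t

lemma flashTime_ne_top_iff {i : Fin N} :
    flashTime h S x y ρ i ≠ ⊤ ↔
      ∃ t, IsFlash h (x i) (y i) (ρ i) (S i) t ∧ S i t ∉ flashCluster h S x y ρ i :=
  iInf_coe_ne_top_iff _

lemma isFlash_of_flashTime_eq {i : Fin N} {t : ℕ} (ht : flashTime h S x y ρ i = t) :
    IsFlash h (x i) (y i) (ρ i) (S i) t :=
  (flashTime_eq_coe_iff.1 ht).1.1

/-- An explorer does not settle at a site where an explorer of smaller index has flashed before
its settling time. -/
lemma flashTime_priority (hT : ∀ i, flashTime h S x y ρ i = T i) {i j : Fin N} (hij : i < j)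
    {t : ℕ} (ht : t ≤ T i) (hf : IsFlash h (x i) (y i) (ρ i) (S i) t) : S j (T j) ≠ S i t := by
  intro heq
  refine (flashTime_eq_coe_iff.1 (hT j)).1.2 ?_
  rw [heq]
  -- At `t = T i` explorer `i` itself occupies the site. At an earlier flash it did not settle, so
  -- the site was already occupied.
  rcases ht.eq_or_lt with rfl | hlt
  · refine cluster_mono (Nat.succ_le_of_lt (Fin.lt_def.1 hij)) ?_
    exact Or.inr ⟨i.2, T i, hT i, rfl⟩
  · have h1 : S i t ∈ flashCluster h S x y ρ i := by
      by_contra hnot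
      exact (flashTime_eq_coe_iff.1 (hT i)).2 t hlt ⟨hf, hnot⟩
    exact cluster_mono (Fin.lt_def.1 hij).le h1

lemma flashCluster_eq_iUnion (hT : ∀ i, flashTime h S x y ρ i = T i) :
    flashCluster h S x y ρ N = ⋃ i, {S i (T i)} := by
  rw [flashCluster, cluster_eq_image hT le_rfl]
  ext z
  simp [eq_comm]

/-- An explorer with good flags in infinitely many shells settles. -/
lemma flashTime_ne_top (hh : ∀ j, 0 < h j) {i : Fin N} (hS : IsPath (S i))
    (hub : IsUnboundedPath (S i)) (hg : ∃ᶠ j in Filter.atTop, GoodFlags h j (x i j) (y i j) (ρ i j)) :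
    flashTime h S x y ρ i ≠ ⊤ := by
  rw [flashTime_ne_top_iff]
  -- The cluster is bounded, so a flash in a sufficiently distant good shell lies outside it.
  have hfin : (flashCluster h S x y ρ i).Finite := cluster_finite _
  obtain ⟨K, hK⟩ := (hfin.image fun z => ‖toEuclid z‖).bddAbove
  obtain ⟨k, hk⟩ := exists_nat_gt K
  obtain ⟨j, hj, hgj⟩ := (Filter.frequently_atTop.1 hg) (k + 1)
  obtain ⟨t, ht⟩ := hgj.exists_isFlashAt (by omega) hh hS hub
  refine ⟨t, ⟨j, ht⟩, fun hmem => ?_⟩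
  have h1 : ‖toEuclid (S i t)‖ ≤ K := hK ⟨_, hmem, rfl⟩
  have h2 := le_norm_of_mem_shell ht.2.1
  have h3 := outerRadius_le_innerRadius (h := h) (j := k) (k := j) (by omega)
  have h4 := le_outerRadius hh k
  linarith

end FlashSettle

/-! ### The internal DLA read along the explorers of the flashing process -/

section Run

variable {d N : ℕ}

/-- The trajectory with steps `ξ`. -/
def walk (ξ : Fin N × ℕ → Lattice d) (i : Fin N) (t : ℕ) : Lattice d :=
  ∑ s ∈ Finset.range t, ξ (i, s)

lemma walk_zero (ξ : Fin N × ℕ → Lattice d) (i : Fin N) : walk ξ i 0 = 0 := by simp [walk]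

lemma walk_succ (ξ : Fin N × ℕ → Lattice d) (i : Fin N) (t : ℕ) :
    walk ξ i (t + 1) = walk ξ i t + ξ (i, t) := by
  simp [walk, Finset.sum_range_succ]

/-- The explorers that may be moved when the explorers `i ≤ n` are at their times `τ i`: of two
explorers `i < j` at the same site, `j` may be moved if `i` is flashing, and `i` otherwise. -/
def movers (S : Fin N → ℕ → Lattice d) (F : Fin N → ℕ → Prop) (n : ℕ) (τ : Fin N → ℕ) :
    Set (Fin N) :=
  {j | (j : ℕ) ≤ n ∧ ∃ i : Fin N, (i : ℕ) ≤ n ∧ S i (τ i) = S j (τ j) ∧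
    (i < j ∧ F i (τ i) ∨ j < i ∧ ¬ F j (τ j))}

/-- A choice of an element of a set, if there is one. -/
noncomputable def pick (s : Set (Fin N)) : Option (Fin N) :=
  open Classical in if hs : s.Nonempty then some hs.some else none

lemma mem_of_pick_eq_some {s : Set (Fin N)} {j : Fin N} (hj : pick s = some j) : j ∈ s := by
  unfold pick at hj
  split_ifs at hj with hs
  exact Option.some.inj hj ▸ hs.some_mem

lemma eq_empty_of_pick_eq_none {s : Set (Fin N)} (hs : pick s = none) : s = ∅ := by
  unfold pick at hs
  split_ifs at hs with hs'
  exact Set.not_nonempty_iff_eq_empty.1 hs'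

/-- The number of settled walks, the number of steps made by the current walk, and the times
reached by the explorers. -/
abbrev RunState (N : ℕ) : Type := ℕ × ℕ × (Fin N → ℕ)

/-- The explorer whose trajectory provides the next step of the current walk. -/
noncomputable def mover (S : Fin N → ℕ → Lattice d) (F : Fin N → ℕ → Prop) (σ : RunState N) :
    Option (Fin N) :=
  if σ.1 < N then pick (movers S F σ.1 σ.2.2) else none

/-- One step of the run: the current walk makes a step, or settles. -/
noncomputable def runStep (σ : RunState N) (o : Option (Fin N)) : RunState N :=
  match o with
  | some j => (σ.1, σ.2.1 + 1, Function.update σ.2.2 j (σ.2.2 j + 1))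
  | none => if σ.1 < N then (σ.1 + 1, 0, σ.2.2) else σ

/-- The state after `m` steps of the run. -/
noncomputable def run (S : Fin N → ℕ → Lattice d) (F : Fin N → ℕ → Prop) : ℕ → RunState N
  | 0 => (0, 0, fun _ => 0)
  | m + 1 => runStep (run S F m) (mover S F (run S F m))

/-- The step of an explorer used at the `m`-th step of the run, and the step of a walk that it
provides. -/
noncomputable def query (S : Fin N → ℕ → Lattice d) (F : Fin N → ℕ → Prop) (m : ℕ) :
    Option ((Fin N × ℕ) × (Fin N × ℕ)) :=
  if hn : (run S F m).1 < N then
    (mover S F (run S F m)).map fun j =>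
      ((j, (run S F m).2.2 j), (⟨(run S F m).1, hn⟩, (run S F m).2.1))
  else none

/-- The steps of the walks, when those that have been assigned during the first `m` steps of the
run are steps `ξ` of the explorers, and the others are `η`. -/
noncomputable def output (ξ η : Fin N × ℕ → Lattice d) (F : Fin N → ℕ → Prop) :
    ℕ → Fin N × ℕ → Lattice d
  | 0 => η
  | m + 1 => match query (walk ξ) F m with
    | some q => Function.update (output ξ η F m) q.2 (ξ q.1)
    | none => output ξ η F m

variable {S : Fin N → ℕ → Lattice d} {F : Fin N → ℕ → Prop}

/-! ### No step of an explorer or of a walk is used twice -/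

lemma query_eq_some_iff {m : ℕ} {a b : Fin N × ℕ} :
    query S F m = some (a, b) ↔ mover S F (run S F m) = some a.1 ∧ a.2 = (run S F m).2.2 a.1 ∧
      (run S F m).1 = b.1 ∧ (run S F m).2.1 = b.2 := by
  obtain ⟨j, s⟩ := a
  obtain ⟨n, t⟩ := b
  unfold query
  split_ifs with hn
  · rw [Option.map_eq_some_iff]
    simp only [Prod.mk.injEq]
    constructor
    · rintro ⟨j, hj, ⟨rfl, rfl⟩, rfl, rfl⟩
      exact ⟨hj, rfl, rfl, rfl⟩
    · rintro ⟨hj, rfl, hn', rfl⟩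
      exact ⟨j, hj, ⟨rfl, rfl⟩, Fin.ext hn', rfl⟩
  · simp only [false_iff]
    rintro ⟨-, -, hn', -⟩
    exact hn (hn'.trans_lt n.2)

lemma mover_eq_some {σ : RunState N} {j : Fin N} (hj : mover S F σ = some j) :
    σ.1 < N ∧ j ∈ movers S F σ.1 σ.2.2 := by
  unfold mover at hj
  split_ifs at hj with hn
  exact ⟨hn, mem_of_pick_eq_some hj⟩

lemma query_eq_of_mover_eq_some {m : ℕ} {j : Fin N} (hj : mover S F (run S F m) = some j) :
    query S F m = some ((j, (run S F m).2.2 j),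
      (⟨(run S F m).1, (mover_eq_some hj).1⟩, (run S F m).2.1)) :=
  query_eq_some_iff.2 ⟨hj, rfl, rfl, rfl⟩

lemma run_succ_of_query {m : ℕ} {a b : Fin N × ℕ} (hq : query S F m = some (a, b)) :
    run S F (m + 1) = ((b.1 : ℕ), b.2 + 1, Function.update (run S F m).2.2 a.1 (a.2 + 1)) := by
  obtain ⟨h1, h2, h3, h4⟩ := query_eq_some_iff.1 hq
  rw [run, h1, runStep, h3, h4, h2]

lemma run_time_mono (i : Fin N) : Monotone fun m => (run S F m).2.2 i := by
  refine monotone_nat_of_le_succ fun m => ?_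
  rw [run]
  rcases mover S F (run S F m) with _ | j
  · simp only [runStep]; split_ifs <;> rfl
  · simp only [runStep, Function.update_apply]
    split_ifs with hij
    · subst hij; omega
    · rfl

/-- The clock of the run: lexicographic comparison of the current walk and of its step. -/
lemma run_clock_le {m m' : ℕ} (hm : m ≤ m') : (run S F m).1 < (run S F m').1 ∨
    (run S F m).1 = (run S F m').1 ∧ (run S F m).2.1 ≤ (run S F m').2.1 := by
  induction m', hm using Nat.le_induction with
  | base => exact Or.inr ⟨rfl, le_rfl⟩
  | succ m' _ ih =>
    rw [run]
    rcases mover S F (run S F m') with _ | j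
    · simp only [runStep]
      split_ifs
      · left; dsimp only; omega
      · exact ih
    · simp only [runStep]; omega

lemma run_clock_lt_of_query {m m' : ℕ} (hm : m < m') {a b : Fin N × ℕ}
    (hq : query S F m = some (a, b)) : (b.1 : ℕ) < (run S F m').1 ∨
    (b.1 : ℕ) = (run S F m').1 ∧ b.2 < (run S F m').2.1 := by
  have := run_clock_le (S := S) (F := F) (Nat.succ_le_of_lt hm)
  rw [Nat.succ_eq_add_one, run_succ_of_query hq] at this
  simpa [Nat.succ_le_iff] using this

/-- The lexicographic clock increases strictly after each assignment. -/
lemma query_snd_ne {m m' : ℕ} (hm : m < m') {a b a' b' : Fin N × ℕ}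
    (hq : query S F m = some (a, b)) (hq' : query S F m' = some (a', b')) : b ≠ b' := by
  rintro rfl
  have h1 := run_clock_lt_of_query hm hq
  obtain ⟨-, -, h3, h4⟩ := query_eq_some_iff.1 hq'
  omega

/-- Using a step of an explorer advances that explorer past it, and explorers never go back. -/
lemma query_fst_ne {m m' : ℕ} (hm : m < m') {a b a' b' : Fin N × ℕ}
    (hq : query S F m = some (a, b)) (hq' : query S F m' = some (a', b')) : a ≠ a' := by
  rintro rfl
  have h1 := run_time_mono (S := S) (F := F) a.1 (Nat.succ_le_of_lt hm)
  simp only [Nat.succ_eq_add_one, run_succ_of_query hq, Function.update_self] at h1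
  obtain ⟨-, h2, -, -⟩ := query_eq_some_iff.1 hq'
  omega

/-! #### Locality -/

variable {S' : Fin N → ℕ → Lattice d} {F' : Fin N → ℕ → Prop}

lemma mover_congr {σ : RunState N} (hS : ∀ i, S i (σ.2.2 i) = S' i (σ.2.2 i))
    (hF : ∀ i, F i (σ.2.2 i) ↔ F' i (σ.2.2 i)) : mover S F σ = mover S' F' σ := by
  simp only [mover, movers, hS, hF]

/-- Up to stage `m` the run inspects each explorer only at times it has reached by stage `m`; its
later steps are still unseen. -/
lemma run_congr {m : ℕ}
    (hS : ∀ i, ∀ t ≤ (run S F m).2.2 i, S i t = S' i t)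
    (hF : ∀ i, ∀ t ≤ (run S F m).2.2 i, (F i t ↔ F' i t)) {k : ℕ} (hk : k ≤ m) :
    run S F k = run S' F' k := by
  induction k with
  | zero => rfl
  | succ k ih =>
    have hle := fun i => run_time_mono (S := S) (F := F) i (show k ≤ m by omega)
    rw [run, run, ← ih (by omega), mover_congr (fun i => hS i _ (hle i)) (fun i => hF i _ (hle i))]

lemma query_congr {m : ℕ}
    (hS : ∀ i, ∀ t ≤ (run S F m).2.2 i, S i t = S' i t)
    (hF : ∀ i, ∀ t ≤ (run S F m).2.2 i, (F i t ↔ F' i t)) {k : ℕ} (hk : k ≤ m) :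
    query S F k = query S' F' k := by
  have hle := fun i => run_time_mono (S := S) (F := F) i hk
  have hr := run_congr hS hF hk
  have hm : mover S F (run S' F' k) = mover S' F' (run S' F' k) := by
    rw [← hr]
    exact mover_congr (fun i => hS i _ (hle i)) (fun i => hF i _ (hle i))
  unfold query
  simp only [hr, hm]

/-! #### The output -/

variable {ξ η : Fin N × ℕ → Lattice d}

lemma output_succ_of_query {m : ℕ} {a b : Fin N × ℕ} (hq : query (walk ξ) F m = some (a, b)) :
    output ξ η F (m + 1) = Function.update (output ξ η F m) b (ξ a) := by
  simp [output, hq]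

lemma output_succ_of_query_none {m : ℕ} (hq : query (walk ξ) F m = none) :
    output ξ η F (m + 1) = output ξ η F m := by
  simp [output, hq]

lemma output_of_query {m m' : ℕ} (hm : m < m') {a b : Fin N × ℕ}
    (hq : query (walk ξ) F m = some (a, b)) : output ξ η F m' b = ξ a := by
  induction m', Nat.succ_le_of_lt hm using Nat.le_induction with
  | base => simp [output_succ_of_query hq]
  | succ m' hm' ih =>
    have hlt : m < m' := hm'
    rcases hq' : query (walk ξ) F m' with _ | ⟨a', b'⟩
    · rw [output_succ_of_query_none hq', ih hlt]
    · rw [output_succ_of_query hq', Function.update_of_ne (query_snd_ne hlt hq hq'), ih hlt]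

lemma output_of_forall_query_ne {b : Fin N × ℕ}
    (hb : ∀ m a, query (walk ξ) F m ≠ some (a, b)) (m : ℕ) : output ξ η F m b = η b := by
  induction m with
  | zero => rfl
  | succ m ih =>
    rcases hq : query (walk ξ) F m with _ | ⟨a', b'⟩
    · rw [output_succ_of_query_none hq, ih]
    · rw [output_succ_of_query hq, Function.update_of_ne, ih]
      rintro rfl
      exact hb m a' hq

/-- Each coordinate is assigned at most once, so it is eventually constant. -/
lemma exists_output_eq (ξ η : Fin N × ℕ → Lattice d) (F : Fin N → ℕ → Prop) (b : Fin N × ℕ) :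
    ∃ M, ∀ m ≥ M, output ξ η F m b = output ξ η F M b := by
  by_cases hb : ∃ m a, query (walk ξ) F m = some (a, b)
  · obtain ⟨m, a, hq⟩ := hb
    refine ⟨m + 1, fun m' hm' => ?_⟩
    rw [output_of_query hm' hq, output_of_query (Nat.lt_succ_self m) hq]
  · push Not at hb
    exact ⟨0, fun m _ => by rw [output_of_forall_query_ne hb, output_of_forall_query_ne hb]⟩

/-- The steps of the walks. -/
noncomputable def finalOutput (ξ η : Fin N × ℕ → Lattice d) (F : Fin N → ℕ → Prop)
    (b : Fin N × ℕ) : Lattice d :=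
  output ξ η F (exists_output_eq ξ η F b).choose b

lemma eventually_output_eq (ξ η : Fin N × ℕ → Lattice d) (F : Fin N → ℕ → Prop)
    (b : Fin N × ℕ) : ∀ᶠ m in Filter.atTop, output ξ η F m b = finalOutput ξ η F b :=
  Filter.eventually_atTop.2 ⟨_, (exists_output_eq ξ η F b).choose_spec⟩

lemma finalOutput_of_query {m : ℕ} {a b : Fin N × ℕ}
    (hq : query (walk ξ) F m = some (a, b)) : finalOutput ξ η F b = ξ a := by
  obtain ⟨m', hm', hlt⟩ := ((eventually_output_eq ξ η F b).and
    (Filter.eventually_gt_atTop m)).exists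
  rw [← hm', output_of_query hlt hq]

end Run

/-! ### The settled configuration -/

section Settled

variable {d N : ℕ} {S : Fin N → ℕ → Lattice d} {F : Fin N → ℕ → Prop} {T : Fin N → ℕ}

/-- In the run, no explorer goes beyond its settling time in the flashing process. -/
lemma run_time_le (hF : ∀ i, F i (T i))
    (hprio : ∀ i j, i < j → ∀ t ≤ T i, F i t → S j (T j) ≠ S i t) (m : ℕ) (i : Fin N) :
    (run S F m).2.2 i ≤ T i := by
  induction m generalizing i with
  | zero => exact Nat.zero_le _
  | succ m ih =>
    rw [run]
    rcases hm : mover S F (run S F m) with _ | j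
    · simp only [runStep]; split_ifs <;> exact ih i
    · simp only [runStep, Function.update_apply]
      split_ifs with hij
      · subst hij
        obtain ⟨-, -, k, -, hpos, hk⟩ := mover_eq_some hm
        -- Suppose the mover stood at its settling time. Either an explorer of smaller index flashes
        -- on the same site, against priority, or the mover is not flashing, although its settling
        -- time is a flashing time.
        refine Nat.succ_le_of_lt (lt_of_le_of_ne (ih i) fun heq => ?_)
        rcases hk with ⟨hki, hFk⟩ | ⟨-, hFi⟩
        · exact hprio k i hki _ (ih k) hFk (by rw [← heq, hpos])
        · exact hFi (heq ▸ hF i)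
      · exact ih i

/-- Two explorers on one site always produce a mover: the later one if the earlier one flashes, the
earlier one if not. -/
lemma injOn_of_movers_eq_empty {n : ℕ} {τ : Fin N → ℕ} (hm : movers S F n τ = ∅) :
    Set.InjOn (fun i => S i (τ i)) {i : Fin N | (i : ℕ) ≤ n} := by
  have key : ∀ i j : Fin N, (i : ℕ) ≤ n → (j : ℕ) ≤ n → i < j → S i (τ i) ≠ S j (τ j) := by
    intro i j hi hj hij heq
    by_cases hFi : F i (τ i)
    · exact (hm ▸ Set.notMem_empty j) ⟨hj, i, hi, heq, Or.inl ⟨hij, hFi⟩⟩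
    · exact (hm ▸ Set.notMem_empty i) ⟨hi, j, hj, heq.symm, Or.inr ⟨hij, hFi⟩⟩
  intro i hi j hj heq
  rcases lt_trichotomy i j with hlt | rfl | hlt
  · exact absurd heq (key i j hi hj hlt)
  · rfl
  · exact absurd heq.symm (key j i hj hi hlt)

/-- The configurations met by the run: the walk `σ.1` is at the position of some explorer `c`, and
the other explorers released so far occupy the cluster of the walks settled so far, with one
explorer on each site. -/
def RunInvariant (S W : Fin N → ℕ → Lattice d) (σ : RunState N) : Prop :=
  (∀ i : Fin N, σ.1 < i → σ.2.2 i = 0) ∧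
  (∀ hn : σ.1 < N, ∃ c : Fin N, (c : ℕ) ≤ σ.1 ∧
    Set.InjOn (fun i => S i (σ.2.2 i)) {i : Fin N | (i : ℕ) ≤ σ.1 ∧ i ≠ c} ∧
    (fun i => S i (σ.2.2 i)) '' {i : Fin N | (i : ℕ) ≤ σ.1 ∧ i ≠ c} = idlaCluster W σ.1 ∧
    S c (σ.2.2 c) = W ⟨σ.1, hn⟩ σ.2.1 ∧ ∀ s < σ.2.1, W ⟨σ.1, hn⟩ s ∈ idlaCluster W σ.1) ∧
  (N ≤ σ.1 → σ.1 = N ∧ Function.Injective (fun i => S i (σ.2.2 i)) ∧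
    Set.range (fun i => S i (σ.2.2 i)) = idlaCluster W N)

variable {W : Fin N → ℕ → Lattice d}

/-- The state just after a release, used initially and after each settlement. The current walk is
carried by the explorer of the same index, still at the origin. -/
lemma runInvariant_released {σ : RunState N} (hS0 : ∀ i, S i 0 = 0) (hW0 : ∀ i, W i 0 = 0)
    (hz : ∀ i : Fin N, σ.1 ≤ i → σ.2.2 i = 0) (ht : σ.2.1 = 0) (hnN : σ.1 ≤ N)
    (hinj : Set.InjOn (fun i => S i (σ.2.2 i)) {i : Fin N | (i : ℕ) < σ.1})
    (him : (fun i => S i (σ.2.2 i)) '' {i : Fin N | (i : ℕ) < σ.1} = idlaCluster W σ.1) :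
    RunInvariant S W σ := by
  refine ⟨fun i hi => hz i hi.le, fun hn => ⟨⟨σ.1, hn⟩, le_rfl, ?_⟩, fun hN => ?_⟩
  · have : {i : Fin N | (i : ℕ) ≤ σ.1 ∧ i ≠ ⟨σ.1, hn⟩} = {i : Fin N | (i : ℕ) < σ.1} := by
      ext i
      simp only [Set.mem_ofPred_eq, ne_eq, Fin.ext_iff]
      omega
    rw [this]
    refine ⟨hinj, him, ?_, ?_⟩
    · rw [hz _ le_rfl, hS0, ht, hW0]
    · intro s hs; omega
  · have hN' : σ.1 = N := le_antisymm hnN hN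
    have : {i : Fin N | (i : ℕ) < σ.1} = Set.univ := by
      ext i; simp [hN']
    rw [this] at hinj him
    rw [Set.image_univ] at him
    exact ⟨hN', Set.injOn_univ.1 hinj, by rw [him, hN']⟩

lemma idlaCluster_succ_of_exit {n : ℕ} (hn : n < N) {t : ℕ} (ht : W ⟨n, hn⟩ t ∉ idlaCluster W n)
    (hlt : ∀ s < t, W ⟨n, hn⟩ s ∈ idlaCluster W n) :
    idlaCluster W (n + 1) = insert (W ⟨n, hn⟩ t) (idlaCluster W n) :=
  cluster_succ_of_eq hn (hitTime_eq_coe_iff.2 ⟨ht, fun s hs => not_not.2 (hlt s hs)⟩)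

/-- Without movers all sites are distinct, so the explorer carrying the walk is outside the cluster
formed by the others: the walk exits exactly now. -/
lemma RunInvariant.settle {σ : RunState N} (hσ : RunInvariant S W σ) (hS0 : ∀ i, S i 0 = 0)
    (hW0 : ∀ i, W i 0 = 0) (hn : σ.1 < N) (hm : movers S F σ.1 σ.2.2 = ∅) :
    RunInvariant S W (σ.1 + 1, 0, σ.2.2) := by
  obtain ⟨c, hc, -, him, hpos, hin⟩ := hσ.2.1 hn
  have hinj := injOn_of_movers_eq_empty hm
  have hset : {i : Fin N | (i : ℕ) < σ.1 + 1} = {i : Fin N | (i : ℕ) ≤ σ.1} := by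
    ext i; simp
  have hset' : {i : Fin N | (i : ℕ) ≤ σ.1} = insert c {i : Fin N | (i : ℕ) ≤ σ.1 ∧ i ≠ c} := by
    ext i
    simp only [Set.mem_ofPred_eq, Set.mem_insert_iff]
    by_cases hi : i = c
    · simp [hi, hc]
    · simp [hi]
  refine runInvariant_released hS0 hW0 (fun i hi => hσ.1 i hi) rfl hn
    (by rw [hset]; exact hinj) ?_
  dsimp only
  rw [idlaCluster_succ_of_exit hn (t := σ.2.1) ?_ hin, hset, hset', Set.image_insert_eq, him, hpos]
  rw [← hpos, ← him]
  rintro ⟨i, ⟨hi, hic⟩, heq⟩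
  exact hic (hinj hi hc heq)

/-- The mover `j` shares its site with another explorer. Since positions are distinct away from `c`,
one of these two is `c`, so `j` stands where the walk is. Then `j` can carry the walk, while `c`, if
different, takes the place of `j` in the cluster. -/
lemma RunInvariant.move {σ : RunState N} (hσ : RunInvariant S W σ) (hn : σ.1 < N) {j : Fin N}
    (hj : j ∈ movers S F σ.1 σ.2.2)
    (hstep : S j (σ.2.2 j) = W ⟨σ.1, hn⟩ σ.2.1 →
      S j (σ.2.2 j + 1) = W ⟨σ.1, hn⟩ (σ.2.1 + 1)) :
    RunInvariant S W (σ.1, σ.2.1 + 1, Function.update σ.2.2 j (σ.2.2 j + 1)) := by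
  obtain ⟨c, hc, hinj, him, hpos, hin⟩ := hσ.2.1 hn
  obtain ⟨hjn, i, hi, hij, hor⟩ := hj
  have hne : i ≠ j := by
    rcases hor with ⟨hlt, -⟩ | ⟨hlt, -⟩
    · exact hlt.ne
    · exact hlt.ne'
  have hjpos : S j (σ.2.2 j) = S c (σ.2.2 c) := by
    by_cases hjc : j = c
    · rw [hjc]
    by_cases hic : i = c
    · rw [← hij, hic]
    exact absurd (hinj ⟨hi, hic⟩ ⟨hjn, hjc⟩ hij) hne
  -- The walk has not exited: its site is also held by an explorer other than `c`.
  have hcur : W ⟨σ.1, hn⟩ σ.2.1 ∈ idlaCluster W σ.1 := by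
    rw [← hpos, ← hjpos, ← him]
    by_cases hjc : j = c
    · exact ⟨i, ⟨hi, hjc ▸ hne⟩, hij⟩
    · exact ⟨j, ⟨hjn, hjc⟩, rfl⟩
  have heqOn : Set.EqOn (fun i => S i (Function.update σ.2.2 j (σ.2.2 j + 1) i))
      (fun i => S i (σ.2.2 i)) {i : Fin N | (i : ℕ) ≤ σ.1 ∧ i ≠ j} := by
    intro k hk
    simp only [Function.update_of_ne hk.2]
  refine ⟨fun k hk => ?_, fun hn' => ⟨j, hjn, ?_, ?_, ?_, ?_⟩, fun hN => absurd hn (not_lt.2 hN)⟩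
  · dsimp only at hk ⊢
    rw [Function.update_of_ne, hσ.1 k hk]
    rintro rfl
    omega
  · refine Set.InjOn.congr ?_ heqOn.symm
    by_cases hjc : j = c
    · rw [hjc]; exact hinj
    intro k hk l hl hkl
    dsimp only at hk hl hkl
    by_cases hkc : k = c
    · by_cases hlc : l = c
      · rw [hkc, hlc]
      · rw [hkc, ← hjpos] at hkl
        exact absurd (hinj ⟨hjn, hjc⟩ ⟨hl.1, hlc⟩ hkl) hl.2.symm
    · by_cases hlc : l = c
      · rw [hlc, ← hjpos] at hkl
        exact absurd (hinj ⟨hk.1, hkc⟩ ⟨hjn, hjc⟩ hkl) hk.2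
      · exact hinj ⟨hk.1, hkc⟩ ⟨hl.1, hlc⟩ hkl
  · dsimp only
    rw [heqOn.image_eq, ← him]
    by_cases hjc : j = c
    · rw [hjc]
    ext z
    constructor
    · rintro ⟨k, hk, rfl⟩
      by_cases hkc : k = c
      · exact ⟨j, ⟨hjn, hjc⟩, by rw [hkc]; exact hjpos⟩
      · exact ⟨k, ⟨hk.1, hkc⟩, rfl⟩
    · rintro ⟨k, hk, rfl⟩
      by_cases hkj : k = j
      · exact ⟨c, ⟨hc, Ne.symm hjc⟩, by rw [hkj]; exact hjpos.symm⟩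
      · exact ⟨k, ⟨hk.1, hkj⟩, rfl⟩
  · dsimp only
    rw [Function.update_self]
    exact hstep (hjpos.trans hpos)
  · intro s hs
    rcases (Nat.lt_succ_iff.1 hs).eq_or_lt with rfl | hlt
    · exact hcur
    · exact hin s hlt

variable {ξ : Fin N × ℕ → Lattice d}

lemma runInvariant_run (hW0 : ∀ i, W i 0 = 0)
    (hW : ∀ m a b, query (walk ξ) F m = some (a, b) → W b.1 (b.2 + 1) = W b.1 b.2 + ξ a) (m : ℕ) :
    RunInvariant (walk ξ) W (run (walk ξ) F m) := by
  induction m with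
  | zero =>
    refine runInvariant_released (walk_zero ξ) hW0 (fun _ _ => rfl) rfl (Nat.zero_le _) ?_ ?_
    · intro i hi; exact absurd hi (Nat.not_lt_zero _)
    · simp [run, idlaCluster, cluster]
  | succ m ih =>
    rcases hm : mover (walk ξ) F (run (walk ξ) F m) with _ | j
    · rw [run, hm]
      simp only [runStep]
      split_ifs with hn
      · rw [mover, if_pos hn] at hm
        exact ih.settle (walk_zero ξ) hW0 hn (eq_empty_of_pick_eq_none hm)
      · exact ih
    · obtain ⟨hn, hj⟩ := mover_eq_some hm
      rw [run, hm]
      refine ih.move hn hj fun hpos => ?_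
      rw [walk_succ, hpos]
      exact (hW m _ _ (query_eq_of_mover_eq_some hm)).symm

/-- The run ends with all walks settled. -/
lemma exists_run_fst_eq (hF : ∀ i, F i (T i))
    (hprio : ∀ i j, i < j → ∀ t ≤ T i, F i t → walk ξ j (T j) ≠ walk ξ i t) :
    ∃ m, N ≤ (run (walk ξ) F m).1 := by
  by_contra! hlt
  -- While walks remain, each stage raises by one the number of settled walks or the total explorer
  -- time; both are bounded.
  have key : ∀ m, m ≤ (run (walk ξ) F m).1 + ∑ i, (run (walk ξ) F m).2.2 i := by
    intro m
    induction m with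
    | zero => exact Nat.zero_le _
    | succ m ih =>
      rw [run]
      rcases hm : mover (walk ξ) F (run (walk ξ) F m) with _ | j
      · simp only [runStep, if_pos (hlt m)]
        omega
      · simp only [runStep]
        rw [Finset.sum_update_of_mem (Finset.mem_univ j)]
        rw [← Finset.add_sum_erase _ _ (Finset.mem_univ j), Finset.erase_eq] at ih
        omega
  have h1 := key (N + ∑ i, T i)
  have h2 := hlt (N + ∑ i, T i)
  have h3 := Finset.sum_le_sum fun i (_ : i ∈ Finset.univ) =>
    run_time_le hF hprio (N + ∑ i, T i) i
  omega

lemma run_eq_of_le {m m' : ℕ} (hN : N ≤ (run S F m).1) (hm : m ≤ m') :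
    run S F m' = run S F m := by
  induction m', hm using Nat.le_induction with
  | base => rfl
  | succ m' _ ih =>
    rw [run, ih, mover, if_neg (not_lt.2 hN), runStep, if_neg (not_lt.2 hN)]

/-- The time at which an explorer of the flashing process is stopped in the internal DLA. -/
noncomputable def finalTime (S : Fin N → ℕ → Lattice d) (F : Fin N → ℕ → Prop) (i : Fin N) : ℕ :=
  ⨆ m, (run S F m).2.2 i

/-- Once all walks have settled the run is stationary, so the supremum is attained and is not the
default value of an unbounded family. -/
lemma finalTime_eq {m : ℕ} (hN : N ≤ (run S F m).1) (i : Fin N) :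
    finalTime S F i = (run S F m).2.2 i := by
  have hle : ∀ m', (run S F m').2.2 i ≤ (run S F m).2.2 i := by
    intro m'
    rcases le_total m m' with hm | hm
    · rw [run_eq_of_le hN hm]
    · exact run_time_mono i hm
  exact le_antisymm (ciSup_le hle) (le_ciSup (f := fun m => (run S F m).2.2 i)
    ⟨_, Set.forall_mem_range.2 hle⟩ m)

/-- If each explorer settles in the flashing process, then the explorers stopped at their final
times form the internal DLA cluster of the walks read along the run, with one explorer on each
site. -/
theorem finalTime_spec (hF : ∀ i, F i (T i))
    (hprio : ∀ i j, i < j → ∀ t ≤ T i, F i t → walk ξ j (T j) ≠ walk ξ i t)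
    (hW0 : ∀ i, W i 0 = 0)
    (hW : ∀ m a b, query (walk ξ) F m = some (a, b) → W b.1 (b.2 + 1) = W b.1 b.2 + ξ a) :
    (∀ i, finalTime (walk ξ) F i ≤ T i) ∧
      Function.Injective (fun i => walk ξ i (finalTime (walk ξ) F i)) ∧
      Set.range (fun i => walk ξ i (finalTime (walk ξ) F i)) = idlaCluster W N := by
  obtain ⟨m, hN⟩ := exists_run_fst_eq hF hprio
  simp only [finalTime_eq hN]
  exact ⟨run_time_le hF hprio m, ((runInvariant_run hW0 hW m).2.2 hN).2⟩

end Settled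

/-! ### Comparison of the two clusters -/

section Comparison

variable {d N : ℕ} {h : ℕ → ℕ} {S : Fin N → ℕ → Lattice d} {x y : Fin N → ℕ → Bool}
  {ρ : Fin N → ℕ → ℝ} {T T' : Fin N → ℕ}

/-- Shells are disjoint, so the flash occurs in a shell of index below `k`, and `IsFlashAt.norm_lt`
confines the whole path up to it. -/
lemma mem_iUnion_shell_of_le (hh : ∀ j, 0 < h j) {x y : ℕ → Bool} {ρ : ℕ → ℝ}
    (hρ : ∀ j, ρ j ≤ h j) {S : ℕ → Lattice d} (hS : IsPath S) {t s k : ℕ}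
    (hf : IsFlash h x y ρ S t) (hs : s ≤ t) (hk : S t ∈ ⋃ j < k, shell d h j) :
    S s ∈ ⋃ j < k, shell d h j := by
  obtain ⟨j, hj⟩ := hf
  have hjk := lt_of_mem_shell_of_mem_iUnion hj.2.1 hk
  obtain ⟨k, rfl⟩ : ∃ k', k = k' + 1 := ⟨k - 1, by omega⟩
  rw [iUnion_shell, mem_latticeBall_zero]
  exact (hj.norm_lt hh (hρ j) hS hs).trans_le (outerRadius_mono (by omega))

/-- The outer inclusion holds explorer by explorer. For the inner one, at least `|U|` explorers have
their flashing site in the union `U` of shells; their sites at times `T'` are distinct and still in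
`U`, so they fill it. -/
theorem shells_comparison (hh : ∀ j, 0 < h j) (hρ : ∀ i j, ρ i j ≤ h j) (hS : ∀ i, IsPath (S i))
    (hT : ∀ i, flashTime h S x y ρ i = T i) (hle : ∀ i, T' i ≤ T i)
    (hinj : Function.Injective fun i => S i (T' i)) (k : ℕ) :
    ((⋃ i, {S i (T i)}) ⊆ (⋃ j < k, shell d h j) →
      (⋃ i, {S i (T' i)}) ⊆ (⋃ j < k, shell d h j)) ∧
    ((⋃ j < k, shell d h j) ⊆ (⋃ i, {S i (T i)}) →
      (⋃ j < k, shell d h j) ⊆ (⋃ i, {S i (T' i)})) := by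
  classical
  have hmem : ∀ i, S i (T i) ∈ (⋃ j < k, shell d h j) → S i (T' i) ∈ (⋃ j < k, shell d h j) :=
    fun i => mem_iUnion_shell_of_le hh (hρ i) (hS i) (isFlash_of_flashTime_eq (hT i)) (hle i)
  generalize (⋃ j < k, shell d h j) = U at hmem
  simp only [Set.iUnion_subset_iff, Set.singleton_subset_iff]
  refine ⟨fun hsub i => hmem i (hsub i), fun hsub => ?_⟩
  have hfin : U.Finite := (Set.finite_iUnion fun i => Set.finite_singleton _).subset hsub
  lift U to Finset (Lattice d) using hfin
  have h1 : U ⊆ (Finset.univ.filter fun i => S i (T i) ∈ U).image fun i => S i (T i) := by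
    intro z hz
    obtain ⟨i, hi⟩ := Set.mem_iUnion.1 (hsub hz)
    rw [Set.mem_singleton_iff] at hi
    exact Finset.mem_image.2 ⟨i, by simpa [← hi] using hz, hi.symm⟩
  have h2 : (Finset.univ.filter fun i => S i (T i) ∈ U).image (fun i => S i (T' i)) = U := by
    refine Finset.eq_of_subset_of_card_le ?_ ?_
    · intro z hz
      obtain ⟨i, hi, rfl⟩ := Finset.mem_image.1 hz
      exact hmem i (Finset.mem_filter.1 hi).2
    · rw [Finset.card_image_of_injective _ hinj]
      exact (Finset.card_le_card h1).trans Finset.card_image_le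
  intro z hz
  rw [Finset.mem_coe, ← h2] at hz
  obtain ⟨i, -, rfl⟩ := Finset.mem_image.1 hz
  exact Set.mem_iUnion.2 ⟨i, rfl⟩

end Comparison

/-! ### Law of the steps read along the run -/

instance instMeasurableSpaceOption {α : Type*} : MeasurableSpace (Option α) := ⊤

instance instDiscreteMeasurableSpaceOption {α : Type*} : DiscreteMeasurableSpace (Option α) :=
  ⟨fun _ => trivial⟩

lemma measurable_comp_of_countable {Ω Q Y : Type*} [MeasurableSpace Ω] [MeasurableSpace Q]
    [MeasurableSpace Y] [Countable Q] [MeasurableSingletonClass Q] {k : Ω → Q}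
    (hk : Measurable k) {g : Q → Ω → Y} (hg : ∀ q, Measurable (g q)) :
    Measurable fun ω => g (k ω) ω :=
  (measurable_from_prod_countable_right (f := fun p : Q × Ω => g p.1 p.2) hg).comp
    (hk.prodMk measurable_id)

/-- Resampling: if `f'` is obtained from `f` by a measure preserving map on each piece of a
countable partition into invariant sets, then `f` and `f'` have the same law. -/
lemma map_eq_map_of_resampling {Ω Q Y : Type*} [MeasurableSpace Ω] [MeasurableSpace Y]
    [Countable Q] [MeasurableSpace Q] [MeasurableSingletonClass Q] {P : Measure Ω} {k : Ω → Q}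
    (hk : Measurable k) {s : Q → Ω → Ω} (hs : ∀ q, MeasurePreserving (s q) P P)
    (hinv : ∀ q ω, k (s q ω) = q ↔ k ω = q) {f f' : Ω → Y} (hf : Measurable f)
    (hf' : Measurable f') (hff' : ∀ ω, f' ω = f (s (k ω) ω)) : P.map f' = P.map f := by
  ext A hA
  rw [Measure.map_apply hf' hA, Measure.map_apply hf hA]
  have key : ∀ B : Set Ω, MeasurableSet B → P B = ∑' q : Q, P (k ⁻¹' {q} ∩ B) := by
    intro B hB
    rw [← measure_iUnion]
    · rw [← Set.iUnion_inter, ← Set.preimage_iUnion, Set.iUnion_singleton_eq_range,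
        Set.range_id', Set.preimage_univ, Set.univ_inter]
    · intro q q' hqq'
      refine Disjoint.mono Set.inter_subset_left Set.inter_subset_left ?_
      exact Disjoint.preimage k (by simpa using hqq')
    · exact fun q => (hk (measurableSet_singleton q)).inter hB
  rw [key _ (hf' hA), key _ (hf hA)]
  refine tsum_congr fun q => ?_
  -- On the piece `k = q`, which `s q` preserves, `f'` is `f ∘ s q`.
  rw [← (hs q).measure_preimage ((hk (measurableSet_singleton q)).inter (hf hA)).nullMeasurableSet]
  congr 1
  ext ω
  simp only [Set.mem_inter_iff, Set.mem_preimage, Set.mem_singleton_iff, hinv]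
  refine and_congr_right fun hq => ?_
  rw [hff', hq]

section Law

variable {d N : ℕ} {Φ : Type*}

/-- The environment: the flags, the steps of the explorers, and additional steps. -/
abbrev Env (Φ : Type*) (d N : ℕ) : Type _ := Φ × ((Fin N × ℕ) ⊕ (Fin N × ℕ) → Lattice d)

/-- The steps of the explorers. -/
def explorerStep (ω : Env Φ d N) (p : Fin N × ℕ) : Lattice d := ω.2 (Sum.inl p)

/-- The additional steps. -/
def extraStep (ω : Env Φ d N) (p : Fin N × ℕ) : Lattice d := ω.2 (Sum.inr p)

/-- The exchange of a step of an explorer and of an additional step. -/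
def exchange (q : Option ((Fin N × ℕ) × (Fin N × ℕ))) (ω : Env Φ d N) : Env Φ d N :=
  match q with
  | none => ω
  | some q => (ω.1, fun i => ω.2 (Equiv.swap (Sum.inl q.1) (Sum.inr q.2) i))

lemma explorerStep_exchange {a b p : Fin N × ℕ} (hp : p ≠ a) (ω : Env Φ d N) :
    explorerStep (exchange (some (a, b)) ω) p = explorerStep ω p := by
  simp only [explorerStep, exchange]
  rw [Equiv.swap_apply_of_ne_of_ne (by simpa using hp) (by simp)]

lemma extraStep_exchange (a b : Fin N × ℕ) (ω : Env Φ d N) :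
    extraStep (exchange (some (a, b)) ω) =
      Function.update (extraStep ω) b (explorerStep ω a) := by
  ext1 p
  by_cases hp : p = b
  · subst hp
    simp [extraStep, exchange, explorerStep]
  · rw [Function.update_of_ne hp]
    simp only [extraStep, exchange]
    rw [Equiv.swap_apply_of_ne_of_ne (by simp) (by simpa using hp)]

lemma exchange_exchange (q : Option ((Fin N × ℕ) × (Fin N × ℕ))) (ω : Env Φ d N) :
    exchange q (exchange q ω) = ω := by
  rcases q with _ | q <;> simp [exchange]

/-- The assigned steps after `m` steps of the run. -/
noncomputable def envOutput (F : Env Φ d N → Fin N → ℕ → Prop) (m : ℕ) (ω : Env Φ d N) :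
    Fin N × ℕ → Lattice d :=
  output (explorerStep ω) (extraStep ω) (F ω) m

/-- The steps of the walks. -/
noncomputable def envFinalOutput (F : Env Φ d N → Fin N → ℕ → Prop) (ω : Env Φ d N) :
    Fin N × ℕ → Lattice d :=
  finalOutput (explorerStep ω) (extraStep ω) (F ω)

lemma eventually_envOutput_eq (F : Env Φ d N → Fin N → ℕ → Prop) (ω : Env Φ d N)
    (b : Fin N × ℕ) : ∀ᶠ m in Filter.atTop, envOutput F m ω b = envFinalOutput F ω b :=
  eventually_output_eq _ _ _ b

variable {F : Env Φ d N → Fin N → ℕ → Prop}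

/-- The exchanged step is the first one that the mover has not yet made, so no position reached so
far depends on it. -/
lemma walk_exchange_of_query {m : ℕ} {a b : Fin N × ℕ} {ω : Env Φ d N}
    (hq : query (walk (explorerStep ω)) (F ω) m = some (a, b)) (i : Fin N) {t : ℕ}
    (ht : t ≤ (run (walk (explorerStep ω)) (F ω) m).2.2 i) :
    walk (explorerStep ω) i t = walk (explorerStep (exchange (some (a, b)) ω)) i t := by
  refine Finset.sum_congr rfl fun s hs => (explorerStep_exchange ?_ ω).symm
  rintro rfl
  have h1 := (query_eq_some_iff.1 hq).2.1
  have h2 := Finset.mem_range.1 hs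
  simp only at h1
  omega

variable [MeasurableSpace Φ]

lemma measurable_explorerStep (p : Fin N × ℕ) :
    Measurable fun ω : Env Φ d N => explorerStep ω p := by
  unfold explorerStep; fun_prop

lemma measurable_extraStep (p : Fin N × ℕ) :
    Measurable fun ω : Env Φ d N => extraStep ω p := by
  unfold extraStep; fun_prop

lemma measurable_walk (i : Fin N) (t : ℕ) :
    Measurable fun ω : Env Φ d N => walk (explorerStep ω) i t := by
  unfold walk
  exact Finset.measurable_sum _ fun s _ => measurable_explorerStep (i, s)

lemma measurePreserving_exchange (ν : Measure Φ) [IsProbabilityMeasure ν]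
    (μ : Measure (Lattice d)) [IsProbabilityMeasure μ]
    (q : Option ((Fin N × ℕ) × (Fin N × ℕ))) :
    MeasurePreserving (exchange q) (ν.prod (Measure.infinitePi fun _ => μ))
      (ν.prod (Measure.infinitePi fun _ => μ)) := by
  rcases q with _ | q
  · exact MeasurePreserving.id _
  · refine (MeasurePreserving.id ν).prod (g := fun (u : (Fin N × ℕ) ⊕ (Fin N × ℕ) → Lattice d) i =>
      u (Equiv.swap (Sum.inl q.1) (Sum.inr q.2) i)) ⟨by fun_prop, ?_⟩
    exact Measure.map_infinitePi_infinitePi_of_inj (P := fun _ => μ) (Equiv.injective _)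

/-- Flashing indicators that are determined by the flags and the past of the trajectory. -/
structure IsAdapted (F : Env Φ d N → Fin N → ℕ → Prop) : Prop where
  congr : ∀ (φ : Φ) (u u' : (Fin N × ℕ) ⊕ (Fin N × ℕ) → Lattice d) (i : Fin N) (t : ℕ),
    (∀ s ≤ t, walk (explorerStep (φ, u)) i s = walk (explorerStep (φ, u')) i s) →
      (F (φ, u) i t ↔ F (φ, u') i t)
  measurableSet : ∀ i t, MeasurableSet {ω | F ω i t}

lemma measurable_mover (hF : IsAdapted F) (σ : RunState N) :
    Measurable fun ω => mover (walk (explorerStep ω)) (F ω) σ := by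
  unfold mover
  split_ifs
  · refine (measurable_of_countable pick).comp (measurable_set_iff.2 fun j => ?_)
    simp only [movers, Set.mem_ofPred_eq]
    refine measurable_const.and (Measurable.exists fun i => measurable_const.and
      (Measurable.and ?_ (Measurable.or (measurable_const.and ?_) (measurable_const.and ?_))))
    · exact measurableSet_setOfPred.1 (measurableSet_eq_fun (measurable_walk _ _) (measurable_walk _ _))
    · exact measurableSet_setOfPred.1 (hF.measurableSet _ _)
    · exact (measurableSet_setOfPred.1 (hF.measurableSet _ _)).not
  · exact measurable_const

lemma measurable_run (hF : IsAdapted F) (m : ℕ) :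
    Measurable fun ω => run (walk (explorerStep ω)) (F ω) m := by
  induction m with
  | zero => exact measurable_const
  | succ m ih =>
    simp only [run]
    refine measurable_comp_of_countable ih
      (g := fun σ ω => runStep σ (mover (walk (explorerStep ω)) (F ω) σ)) fun σ => ?_
    exact (measurable_of_countable (runStep σ)).comp (measurable_mover hF σ)

lemma measurable_query (hF : IsAdapted F) (m : ℕ) :
    Measurable fun ω => query (walk (explorerStep ω)) (F ω) m := by
  unfold query
  refine measurable_comp_of_countable (measurable_run hF m)
      (g := fun σ ω => if hn : σ.1 < N then (mover (walk (explorerStep ω)) (F ω) σ).map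
        fun j => ((j, σ.2.2 j), ((⟨σ.1, hn⟩ : Fin N), σ.2.1)) else none) fun σ => ?_
  split_ifs with hn
  · exact (measurable_of_countable (Option.map _)).comp (measurable_mover hF σ)
  · exact measurable_const

lemma measurable_envOutput (hF : IsAdapted F) (m : ℕ) : Measurable (envOutput F m) := by
  refine measurable_pi_iff.2 fun b => ?_
  induction m with
  | zero => exact measurable_extraStep b
  | succ m ih =>
    refine measurable_comp_of_countable (measurable_query hF m)
      (g := fun (q : Option ((Fin N × ℕ) × (Fin N × ℕ))) ω => (match q with
        | some q => Function.update (envOutput F m ω) q.2 (explorerStep ω q.1)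
        | none => envOutput F m ω) b) fun q => ?_
    rcases q with _ | q
    · exact ih
    · simp only [Function.update_apply]
      split_ifs
      · exact measurable_explorerStep _
      · exact ih

/-- The queries up to `m` are decided without seeing the step that query `m` selects, so the
exchange does not alter them. -/
lemma query_exchange_of_query (hF : IsAdapted F) {m : ℕ} {a b : Fin N × ℕ} {ω : Env Φ d N}
    (hq : query (walk (explorerStep ω)) (F ω) m = some (a, b)) {k : ℕ} (hk : k ≤ m) :
    query (walk (explorerStep (exchange (some (a, b)) ω))) (F (exchange (some (a, b)) ω)) k =
      query (walk (explorerStep ω)) (F ω) k := by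
  refine (query_congr (fun i t ht => walk_exchange_of_query hq i ht) (fun i t ht => ?_) hk).symm
  exact hF.congr _ _ _ i t fun s hs => walk_exchange_of_query hq i (hs.trans ht)

lemma query_exchange_iff (hF : IsAdapted F) (m : ℕ) (q : Option ((Fin N × ℕ) × (Fin N × ℕ)))
    (ω : Env Φ d N) :
    query (walk (explorerStep (exchange q ω))) (F (exchange q ω)) m = q ↔
      query (walk (explorerStep ω)) (F ω) m = q := by
  rcases q with _ | ⟨a, b⟩
  · rfl
  · refine ⟨fun hq => ?_, fun hq => (query_exchange_of_query hF hq le_rfl).trans hq⟩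
    have := query_exchange_of_query hF hq le_rfl
    rw [exchange_exchange] at this
    exact this.trans hq

/-- The exchange puts the step `a` into the reserve at `b`. Earlier assignments involve neither `a`
nor `b`, so they commute with this update. -/
lemma envOutput_exchange (hF : IsAdapted F) {m : ℕ} {a b : Fin N × ℕ} {ω : Env Φ d N}
    (hq : query (walk (explorerStep ω)) (F ω) m = some (a, b)) {k : ℕ} (hk : k ≤ m) :
    envOutput F k (exchange (some (a, b)) ω) =
      Function.update (envOutput F k ω) b (explorerStep ω a) := by
  induction k with
  | zero => exact extraStep_exchange a b ω
  | succ k ih =>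
    have ih := ih (by omega)
    have hqk := query_exchange_of_query hF hq (show k ≤ m by omega)
    unfold envOutput at ih ⊢
    rcases hq' : query (walk (explorerStep ω)) (F ω) k with _ | ⟨a', b'⟩
    · rw [output_succ_of_query_none hq', output_succ_of_query_none (hqk.trans hq'), ih]
    · rw [output_succ_of_query hq', output_succ_of_query (hqk.trans hq'), ih,
        explorerStep_exchange (query_fst_ne hk hq' hq),
        Function.update_comm (query_snd_ne hk hq' hq).symm]

/-- Turns an assignment into an exchange of environments, the form required for resampling. -/
lemma envOutput_succ (hF : IsAdapted F) (m : ℕ) (ω : Env Φ d N) :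
    envOutput F (m + 1) ω =
      envOutput F m (exchange (query (walk (explorerStep ω)) (F ω) m) ω) := by
  rcases hq : query (walk (explorerStep ω)) (F ω) m with _ | ⟨a, b⟩
  · exact output_succ_of_query_none hq
  · rw [envOutput_exchange hF hq le_rfl]
    exact output_succ_of_query hq

/-! ### The assigned steps are i.i.d. -/

variable (ν : Measure Φ) [IsProbabilityMeasure ν] (μ : Measure (Lattice d))
  [IsProbabilityMeasure μ]

lemma map_envOutput (hF : IsAdapted F) (m : ℕ) :
    (ν.prod (Measure.infinitePi fun _ => μ)).map (envOutput F m) =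
      Measure.infinitePi fun _ => μ := by
  induction m with
  | zero =>
    have h1 : envOutput F 0 =
        (fun u (p : Fin N × ℕ) => u (Sum.inr p : (Fin N × ℕ) ⊕ (Fin N × ℕ))) ∘ Prod.snd := rfl
    rw [h1, ← Measure.map_map (by fun_prop) measurable_snd, ← Measure.snd, Measure.snd_prod]
    exact Measure.map_infinitePi_infinitePi_of_inj (P := fun _ => μ) Sum.inr_injective
  | succ m ih =>
    rw [← ih]
    exact map_eq_map_of_resampling (measurable_query hF m)
      (fun q => measurePreserving_exchange ν μ q) (query_exchange_iff hF m)
      (measurable_envOutput hF m) (measurable_envOutput hF (m + 1)) (envOutput_succ hF m)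

lemma measurable_envFinalOutput (hF : IsAdapted F) : Measurable (envFinalOutput F) := by
  refine measurable_pi_iff.2 fun b => ?_
  intro A hA
  have : (fun ω => envFinalOutput F ω b) ⁻¹' A =
      ⋃ M, ⋂ m, ⋂ (_ : M ≤ m), (fun ω => envOutput F m ω b) ⁻¹' A := by
    ext ω
    simp only [Set.mem_preimage, Set.mem_iUnion, Set.mem_iInter]
    constructor
    · intro hA'
      obtain ⟨M, hM⟩ := Filter.eventually_atTop.1 (eventually_envOutput_eq F ω b)
      exact ⟨M, fun m hm => (hM m hm).symm ▸ hA'⟩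
    · rintro ⟨M, hM⟩
      obtain ⟨m, hm, hMm⟩ := ((eventually_envOutput_eq F ω b).and
        (Filter.eventually_ge_atTop M)).exists
      exact hm ▸ hM m hMm
  rw [this]
  exact MeasurableSet.iUnion fun M => MeasurableSet.iInter fun m => MeasurableSet.iInter fun _ =>
    (measurable_pi_iff.1 (measurable_envOutput hF m) b) hA

/-- The steps of the walks are independent, with the law of the steps of the explorers. -/
theorem map_envFinalOutput (hF : IsAdapted F) :
    (ν.prod (Measure.infinitePi fun _ => μ)).map (envFinalOutput F) =
      Measure.infinitePi fun _ => μ := by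
  refine Measure.eq_infinitePi _ fun s t ht => ?_
  have hs : MeasurableSet ((s : Set (Fin N × ℕ)).pi t) :=
    MeasurableSet.pi s.countable_toSet fun b _ => ht b
  rw [Measure.map_apply (measurable_envFinalOutput hF) hs]
  -- A cylinder involves finitely many coordinates, all eventually constant, so its indicators
  -- converge; its probability does not depend on `m`.
  have hlim : Filter.Tendsto (fun m => (ν.prod (Measure.infinitePi fun _ => μ))
      (envOutput F m ⁻¹' (s : Set (Fin N × ℕ)).pi t)) Filter.atTop
      (nhds ((ν.prod (Measure.infinitePi fun _ => μ))
        (envFinalOutput F ⁻¹' (s : Set (Fin N × ℕ)).pi t))) := by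
    refine tendsto_measure_of_tendsto_indicator_of_isFiniteMeasure Filter.atTop _
      (fun m => measurable_envOutput hF m hs) fun ω => ?_
    have : ∀ᶠ m in Filter.atTop, ∀ b ∈ s, envOutput F m ω b = envFinalOutput F ω b :=
      (Filter.eventually_all_finset s).2 fun b _ => eventually_envOutput_eq F ω b
    filter_upwards [this] with m hm
    simp only [Set.mem_preimage, Set.mem_pi, Finset.mem_coe]
    exact forall₂_congr fun b hb => by rw [hm b hb]
  have hconst : ∀ m, (ν.prod (Measure.infinitePi fun _ => μ))
      (envOutput F m ⁻¹' (s : Set (Fin N × ℕ)).pi t) = ∏ b ∈ s, μ (t b) := by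
    intro m
    rw [← Measure.map_apply (measurable_envOutput hF m) hs, map_envOutput ν μ hF,
      Measure.infinitePi_pi _ fun b _ => ht b]
  simp only [hconst] at hlim
  exact tendsto_nhds_unique hlim tendsto_const_nhds |>.symm ▸ rfl

end Law

/-! ### Measurability of flashing and settling times -/

section Measurability

variable {d N : ℕ} {h : ℕ → ℕ} {Ω : Type*} [MeasurableSpace Ω]

lemma mem_localTarget_iff {j : ℕ} {x y : Bool} {ρ : ℝ} {z w : Lattice d} :
    w ∈ localTarget h j x y ρ z ↔ x = true ∨ (y = true ∧
      min ρ (shellRadius h j + h j - ‖toEuclid z‖) ≤ ‖toEuclid w - toEuclid z‖) ∨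
      (y = false ∧ (‖toEuclid w‖ < shellRadius h j - ρ ∨ shellRadius h j + ρ ≤ ‖toEuclid w‖)) := by
  rcases x with _ | _ <;> rcases y with _ | _ <;> simp [localTarget]

lemma measurable_mem {S : Ω → Lattice d} (hS : Measurable S) (Λ : Set (Lattice d)) :
    Measurable fun ω => S ω ∈ Λ :=
  measurableSet_setOfPred.1 (hS Λ.to_countable.measurableSet)

lemma measurable_firstHit {S : ℕ → Ω → Lattice d} {Λ : Ω → Set (Lattice d)}
    (hΛ : ∀ t, Measurable fun ω => S t ω ∈ Λ ω) (k : ℕ) :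
    Measurable fun ω => FirstHit (Λ ω) (fun t => S t ω) k :=
  (hΛ k).and (Measurable.forall fun l => Measurable.forall fun _ => (hΛ l).not)

lemma measurable_isFlashAt {S : ℕ → Ω → Lattice d} (hS : ∀ t, Measurable (S t)) {x y : Ω → Bool}
    (hx : Measurable x) (hy : Measurable y) {ρ : Ω → ℝ} (hρ : Measurable ρ) (j t : ℕ) :
    Measurable fun ω => IsFlashAt h j (x ω) (y ω) (ρ ω) (fun t => S t ω) t := by
  simp only [isFlashAt_iff]
  have hE : ∀ t, Measurable fun ω => toEuclid (S t ω) := fun t =>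
    (measurable_of_countable toEuclid).comp (hS t)
  refine Measurable.exists fun H => measurable_const.and ((measurable_firstHit
    (fun t => measurable_mem (hS t) _) H).and (Measurable.and ?_ ?_))
  · refine measurable_firstHit (S := fun s => S (H + s)) (fun s => ?_) _
    simp only [mem_localTarget_iff]
    have h1 := hE H
    have h2 := hE (H + s)
    refine Measurable.or ?_ (Measurable.or (Measurable.and ?_ ?_) (Measurable.and ?_
      (Measurable.or ?_ ?_)))
    · exact measurableSet_setOfPred.1 (hx (measurableSet_singleton true))
    · exact measurableSet_setOfPred.1 (hy (measurableSet_singleton true))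
    · exact measurableSet_setOfPred.1 (measurableSet_le (by fun_prop) (by fun_prop))
    · exact measurableSet_setOfPred.1 (hy (measurableSet_singleton false))
    · exact measurableSet_setOfPred.1 (measurableSet_lt (by fun_prop) (by fun_prop))
    · exact measurableSet_setOfPred.1 (measurableSet_le (by fun_prop) (by fun_prop))
  · exact measurable_comp_of_countable (hS H) (g := fun z ω => S t ω ∈ cell h j z)
      fun z => measurable_mem (hS t) _

lemma measurable_isFlash {S : ℕ → Ω → Lattice d} (hS : ∀ t, Measurable (S t)) {x y : ℕ → Ω → Bool}
    (hx : ∀ j, Measurable (x j)) (hy : ∀ j, Measurable (y j)) {ρ : ℕ → Ω → ℝ}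
    (hρ : ∀ j, Measurable (ρ j)) (t : ℕ) : Measurable fun ω =>
      IsFlash h (fun j => x j ω) (fun j => y j ω) (fun j => ρ j ω) (fun t => S t ω) t :=
  Measurable.exists fun j => measurable_isFlashAt hS (hx j) (hy j) (hρ j) j t

variable {S : Fin N → ℕ → Ω → Lattice d} {X Y : Fin N → ℕ → Ω → Bool} {R : Fin N → ℕ → Ω → ℝ}

lemma measurable_flashTime_eq (hS : ∀ i t, Measurable (S i t)) (hX : ∀ i j, Measurable (X i j))
    (hY : ∀ i j, Measurable (Y i j)) (hR : ∀ i j, Measurable (R i j)) {i : Fin N}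
    (hC : ∀ z, Measurable fun ω => z ∈ flashCluster h (fun i t => S i t ω) (fun i j => X i j ω)
      (fun i j => Y i j ω) (fun i j => R i j ω) i) (t : ℕ) :
    Measurable fun ω => flashTime h (fun i t => S i t ω) (fun i j => X i j ω)
      (fun i j => Y i j ω) (fun i j => R i j ω) i = t := by
  simp only [flashTime_eq_coe_iff]
  have key : ∀ t, Measurable fun ω => IsFlash h (fun j => X i j ω) (fun j => Y i j ω)
      (fun j => R i j ω) (fun t => S i t ω) t ∧ S i t ω ∉ flashCluster h (fun i t => S i t ω)
        (fun i j => X i j ω) (fun i j => Y i j ω) (fun i j => R i j ω) i := fun t =>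
    (measurable_isFlash (hS i) (hX i) (hY i) (hR i) t).and
      (measurable_comp_of_countable (hS i t) (g := fun z ω => z ∉ flashCluster h
        (fun i t => S i t ω) (fun i j => X i j ω) (fun i j => Y i j ω) (fun i j => R i j ω) i)
        fun z => (hC z).not)
  exact (key t).and (Measurable.forall fun l => Measurable.forall fun _ => (key l).not)

/-- Follows the recursion of the process: the cluster found by an explorer determines its settling
time, hence the next cluster. -/
lemma measurable_mem_flashCluster (hS : ∀ i t, Measurable (S i t))
    (hX : ∀ i j, Measurable (X i j)) (hY : ∀ i j, Measurable (Y i j))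
    (hR : ∀ i j, Measurable (R i j)) (n : ℕ) (z : Lattice d) :
    Measurable fun ω => z ∈ flashCluster h (fun i t => S i t ω) (fun i j => X i j ω)
      (fun i j => Y i j ω) (fun i j => R i j ω) n := by
  induction n generalizing z with
  | zero => exact measurable_const
  | succ n ih =>
    refine (ih z).or (Measurable.exists fun hn => Measurable.exists fun t => Measurable.and ?_ ?_)
    · exact measurable_flashTime_eq (i := ⟨n, hn⟩) hS hX hY hR ih t
    · exact measurable_mem (hS _ t) {z}

lemma measurable_flashTime_toNat (hS : ∀ i t, Measurable (S i t)) (hX : ∀ i j, Measurable (X i j))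
    (hY : ∀ i j, Measurable (Y i j)) (hR : ∀ i j, Measurable (R i j)) (i : Fin N) :
    Measurable fun ω => (flashTime h (fun i t => S i t ω) (fun i j => X i j ω)
      (fun i j => Y i j ω) (fun i j => R i j ω) i).toNat := by
  have key := fun t => measurable_flashTime_eq (h := h) (i := i) hS hX hY hR
    (measurable_mem_flashCluster hS hX hY hR i) t
  refine measurable_to_countable' fun t => ?_
  -- `toNat` sends `⊤` to `0`, so the fibre over `0` also contains the event that the explorer does
  -- not settle.
  have : (fun ω => (flashTime h (fun i t => S i t ω) (fun i j => X i j ω)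
      (fun i j => Y i j ω) (fun i j => R i j ω) i).toNat) ⁻¹' {t} =
    {ω | flashTime h (fun i t => S i t ω) (fun i j => X i j ω)
      (fun i j => Y i j ω) (fun i j => R i j ω) i = t ∨ (t = 0 ∧ ∀ s : ℕ,
        ¬ flashTime h (fun i t => S i t ω) (fun i j => X i j ω)
      (fun i j => Y i j ω) (fun i j => R i j ω) i = s)} := by
    ext ω
    simp only [Set.mem_preimage, Set.mem_singleton_iff, Set.mem_ofPred_eq]
    generalize flashTime h (fun i t => S i t ω) (fun i j => X i j ω)
      (fun i j => Y i j ω) (fun i j => R i j ω) i = τ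
    induction τ using ENat.recTopCoe with
    | top => simp [eq_comm]
    | coe a => simp
  rw [this]
  exact measurableSet_setOfPred.2 ((key t).or
    (measurable_const.and (Measurable.forall fun s => (key s).not)))

end Measurability

/-! ### The laws of the steps, flags and radii -/

section Laws

variable {d : ℕ}

lemma isProbabilityMeasure_stepLaw (hd : 1 ≤ d) : IsProbabilityMeasure (stepLaw d) := by
  constructor
  have hd0 : ((2 * d : ℕ) : ℝ≥0∞) ≠ 0 := by simp; omega
  simp only [stepLaw, Measure.coe_finsetSum, Finset.sum_apply, Measure.add_apply,
    Measure.smul_apply, measure_univ, smul_eq_mul, mul_one, Finset.sum_const, Finset.card_univ,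
    Fintype.card_fin, nsmul_eq_mul]
  rw [← two_mul, ← mul_assoc, mul_comm (d : ℝ≥0∞) 2]
  have : (2 * d : ℝ≥0∞) = ((2 * d : ℕ) : ℝ≥0∞) := by push_cast; rfl
  rw [this]
  exact ENNReal.mul_inv_cancel hd0 (ENNReal.natCast_ne_top _)

lemma stepLaw_single_ne_zero (i : Fin d) : stepLaw d {Pi.single i 1} ≠ 0 := by
  intro h0
  simp only [stepLaw, Measure.coe_finsetSum, Finset.sum_apply] at h0
  have h1 := (Finset.sum_eq_zero_iff.1 h0) i (Finset.mem_univ i)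
  simp only [Measure.add_apply, Measure.smul_apply, smul_eq_mul, add_eq_zero, mul_eq_zero,
    ENNReal.inv_eq_zero, ENNReal.natCast_ne_top, false_or] at h1
  simp at h1

lemma norm_toEuclid_single (i : Fin d) (a : ℤ) :
    ‖toEuclid (Pi.single i a : Lattice d)‖ = |(a : ℝ)| := by
  have : toEuclid (Pi.single i a : Lattice d) = PiLp.single 2 i (a : ℝ) := by
    ext k
    simp only [toEuclid, PiLp.single_apply, Pi.single_apply]
    split_ifs <;> simp
  rw [this, PiLp.norm_single, Real.norm_eq_abs]

lemma ae_stepLaw : ∀ᵐ z ∂(stepLaw d), ‖toEuclid z‖ = 1 := by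
  have hs : MeasurableSet {z : Lattice d | ‖toEuclid z‖ = 1}ᶜ :=
    (Set.to_countable _).measurableSet
  rw [ae_iff]
  change stepLaw d {z : Lattice d | ‖toEuclid z‖ = 1}ᶜ = 0
  simp only [stepLaw, Measure.coe_finsetSum, Finset.sum_apply]
  refine Finset.sum_eq_zero fun i _ => ?_
  rw [Measure.add_apply, Measure.smul_apply, Measure.smul_apply, Measure.dirac_apply' _ hs,
    Measure.dirac_apply' _ hs]
  simp [norm_toEuclid_single]

lemma isProbabilityMeasure_bernoulliLaw {p : ℝ} (hp0 : 0 ≤ p) (hp1 : p ≤ 1) :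
    IsProbabilityMeasure (bernoulliLaw p) := by
  constructor
  simp only [bernoulliLaw, Measure.add_apply, Measure.smul_apply, measure_univ, smul_eq_mul,
    mul_one]
  rw [← ENNReal.ofReal_add hp0 (by linarith)]
  simp

lemma bernoulliLaw_true (p : ℝ) : bernoulliLaw p {true} = ENNReal.ofReal p := by
  simp [bernoulliLaw]

lemma radiusLaw_Iic (hd : 1 ≤ d) {m : ℕ} {c : ℝ} (hc0 : 0 ≤ c) (hcm : c ≤ m) :
    radiusLaw d m (Set.Iic c) = ENNReal.ofReal ((c / m) ^ d) := by
  have hset : Set.Iic c ∩ Set.Icc (0 : ℝ) m = Set.Icc 0 c := by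
    ext x
    simp only [Set.mem_inter_iff, Set.mem_Iic, Set.mem_Icc]
    constructor
    · rintro ⟨h1, h2, h3⟩; exact ⟨h2, h1⟩
    · rintro ⟨h1, h2⟩; exact ⟨h2, h1, h2.trans hcm⟩
  rw [radiusLaw, withDensity_apply _ measurableSet_Iic, Measure.restrict_restrict measurableSet_Iic,
    hset, ← ofReal_integral_eq_lintegral_ofReal]
  · rw [integral_Icc_eq_integral_Ioc, ← intervalIntegral.integral_of_le hc0]
    congr 1
    rw [intervalIntegral.integral_div, intervalIntegral.integral_const_mul, integral_pow]
    obtain ⟨d, rfl⟩ : ∃ k, d = k + 1 := ⟨d - 1, by omega⟩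
    have : ((d : ℝ) + 1) ≠ 0 := by positivity
    simp only [Nat.add_sub_cancel, div_pow]
    push_cast
    field_simp
    simp
  · exact Continuous.integrableOn_Icc (by fun_prop)
  · refine (ae_restrict_iff' measurableSet_Icc).2 (ae_of_all _ fun x hx => ?_)
    have := hx.1
    simp only [Pi.zero_apply]
    positivity

lemma radiusLaw_Ioi (m : ℕ) : radiusLaw d m (Set.Ioi (m : ℝ)) = 0 := by
  refine withDensity_absolutelyContinuous _ _ ?_
  rw [Measure.restrict_apply measurableSet_Ioi]
  have : Set.Ioi (m : ℝ) ∩ Set.Icc 0 (m : ℝ) = ∅ := by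
    ext x; simpa using fun h _ => h
  simp [this]

lemma isProbabilityMeasure_radiusLaw (hd : 1 ≤ d) {m : ℕ} (hm : 0 < m) :
    IsProbabilityMeasure (radiusLaw d m) := by
  constructor
  have hm' : (m : ℝ) ≠ 0 := by positivity
  rw [← Set.Iic_union_Ioi (a := (m : ℝ)), measure_union (Set.Iic_disjoint_Ioi le_rfl)
    measurableSet_Ioi, radiusLaw_Ioi, radiusLaw_Iic hd (by positivity) le_rfl, div_self hm']
  simp

end Laws

/-! ### Product measures -/

section Pairing

variable {ι E F : Type*} [MeasurableSpace E] [MeasurableSpace F]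
  (μ : ι → Measure E) [∀ p, IsProbabilityMeasure (μ p)]
  (ν : ι → Measure F) [∀ p, IsProbabilityMeasure (ν p)]

/-- Regroups a product of steps and a product of flags into a product of pairs. On a cylinder,
integrating over `ν` leaves a product of functions of distinct coordinates, which are independent
under `μ`. -/
lemma map_pair_infinitePi :
    ((Measure.infinitePi μ).prod (Measure.infinitePi ν)).map (fun u p => (u.1 p, u.2 p)) =
      Measure.infinitePi fun p => (μ p).prod (ν p) := by
  refine Measure.eq_infinitePi _ fun s t ht => ?_
  have hs : MeasurableSet ((s : Set ι).pi t) := MeasurableSet.pi s.countable_toSet fun b _ => ht b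
  have hm : Measurable fun (u : (ι → E) × (ι → F)) p => (u.1 p, u.2 p) := by fun_prop
  rw [Measure.map_apply hm hs, Measure.prod_apply (hm hs)]
  have h1 : ∀ u : ι → E, Measure.infinitePi ν (Prod.mk u ⁻¹'
      ((fun (u : (ι → E) × (ι → F)) p => (u.1 p, u.2 p)) ⁻¹' (s : Set ι).pi t)) =
      ∏ p ∈ s, ν p (Prod.mk (u p) ⁻¹' t p) := by
    intro u
    rw [← Measure.infinitePi_pi _ fun b _ => measurable_prodMk_left (ht b)]
    rfl
  have h2 : ∀ p, Measurable fun x => ν p (Prod.mk x ⁻¹' t p) := fun p =>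
    measurable_measure_prodMk_left (ht p)
  simp only [h1]
  have hind := iIndepFun_infinitePi (P := μ) (X := fun p x => ν p (Prod.mk x ⁻¹' t p)) h2
  have hprod := lintegral_prod_eq_prod_lintegral_of_indepFun s
    (fun p (u : ι → E) => ν p (Prod.mk (u p) ⁻¹' t p)) hind
    (fun p => (h2 p).comp (measurable_pi_apply p))
  rw [hprod]
  refine Finset.prod_congr rfl fun p _ => ?_
  rw [Measure.prod_apply (ht p), ← Measure.infinitePi_map_eval μ p,
    lintegral_map (h2 p) (measurable_pi_apply p)]

end Pairing

/-! ### Almost sure properties of the explorers -/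

section AlmostSure

variable {d N : ℕ} {h : ℕ → ℕ} {Ω : Type*} [MeasurableSpace Ω] {P : Measure Ω}

/-- An independent sequence which takes a value with positive probability takes it, almost surely,
`K` times in a row. -/
lemma ae_exists_block {E : Type*} [MeasurableSpace E] [MeasurableSingletonClass E]
    {Z : ℕ → Ω → E} (hZ : ∀ t, Measurable (Z t)) (hind : iIndepFun Z P) {e : E} {p : ℝ≥0∞}
    (hp : p ≠ 0) (hlaw : ∀ t, P (Z t ⁻¹' {e}) = p) (K : ℕ) (hK : K ≠ 0) :
    ∀ᵐ ω ∂P, ∃ n, ∀ k < K, Z (n + k) ω = e := by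
  have := hind.isProbabilityMeasure
  have : NeZero K := ⟨hK⟩
  have hind' : iIndepFun (fun q : ℕ × Fin K => Z (q.1 * K + q.2)) P :=
    hind.precomp (Nat.divModEquiv K).symm.injective
  -- Disjoint blocks of length `K` are independent and each succeeds with probability `p ^ K > 0`,
  -- so the second Borel–Cantelli lemma applies.
  let B : ℕ → Set Ω := fun n => ⋂ k : Fin K, Z (n * K + k) ⁻¹' {e}
  have hBm : ∀ n, MeasurableSet (B n) := fun n =>
    MeasurableSet.iInter fun k => hZ _ (measurableSet_singleton e)
  have hmeas : ∀ s : Finset ℕ, P (⋂ n ∈ s, B n) = ∏ _n ∈ s, p ^ K := by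
    intro s
    have h1 : (⋂ n ∈ s, B n) =
        ⋂ q ∈ s ×ˢ (Finset.univ : Finset (Fin K)), Z (q.1 * K + q.2) ⁻¹' {e} := by
      ext ω
      simp only [B, Set.mem_iInter, Set.mem_preimage, Finset.mem_product, Finset.mem_univ,
        and_true, Prod.forall]
      exact forall_congr' fun n => forall_comm
    rw [h1, hind'.meas_biInter fun q _ => ⟨{e}, measurableSet_singleton e, rfl⟩,
      Finset.prod_product]
    simp [hlaw]
  have hBp : ∀ n, P (B n) = p ^ K := fun n => by simpa using hmeas {n}
  have hB : iIndepSet B P := (iIndepSet_iff_meas_biInter hBm).2 fun s => by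
    rw [hmeas]; simp [hBp]
  have hlim := measure_limsup_eq_one hBm hB (by
    simp only [hBp]
    exact ENNReal.tsum_const_eq_top_of_ne_zero (pow_ne_zero _ hp))
  have hae : ∀ᵐ ω ∂P, ω ∈ Filter.limsup B Filter.atTop :=
    (mem_ae_iff_prob_eq_one (MeasurableSet.measurableSet_limsup hBm)).2 hlim
  filter_upwards [hae] with ω hω
  obtain ⟨n, hn⟩ := (Filter.mem_limsup_iff_frequently_mem.1 hω).exists
  exact ⟨n * K, fun k hk => Set.mem_iInter.1 hn ⟨k, hk⟩⟩

/-- A run of `M > 2K` equal unit steps displaces the path by `M`, so its two ends cannot both have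
norm below `K`. The argument is the same in every dimension. -/
lemma isUnboundedPath_of_blocks {S : ℕ → Lattice d} (i : Fin d)
    (hS : ∀ K ≠ 0, ∃ n, ∀ k < K, S (n + k + 1) - S (n + k) = Pi.single i 1) :
    IsUnboundedPath S := by
  intro K
  obtain ⟨M, hM⟩ := exists_nat_gt (max (2 * K) 0)
  have hM0 : M ≠ 0 := by
    rintro rfl
    exact absurd ((le_max_right _ _).trans_lt hM) (by simp)
  obtain ⟨n, hn⟩ := hS M hM0
  have hsum : ∀ k ≤ M, S (n + k) = S n + Pi.single i (k : ℤ) := by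
    intro k
    induction k with
    | zero => simp
    | succ k ih =>
      intro hk
      have h1 := hn k (by omega)
      rw [← add_assoc, ← sub_add_cancel (S (n + k + 1)) (S (n + k)), h1, ih (by omega)]
      push_cast
      rw [Pi.single_add]
      abel
  by_contra! hlt
  have h1 : toEuclid (Pi.single i (M : ℤ) : Lattice d) = toEuclid (S (n + M)) - toEuclid (S n) := by
    rw [hsum M le_rfl]
    ext k
    simp [toEuclid]
  have h2 := norm_toEuclid_single i (M : ℤ)
  rw [h1] at h2
  have h3 := norm_sub_le (toEuclid (S (n + M))) (toEuclid (S n))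
  have h4 := hlt n
  have h5 := hlt (n + M)
  have h6 := (le_max_left _ _).trans_lt hM
  rw [h2, Int.cast_natCast, abs_of_nonneg (Nat.cast_nonneg M)] at h3
  linarith

variable {S : Fin N → ℕ → Ω → Lattice d} {X Y : Fin N → ℕ → Ω → Bool} {R : Fin N → ℕ → Ω → ℝ}

lemma isProbabilityMeasure_flagY (j : ℕ) :
    IsProbabilityMeasure (bernoulliLaw (if j = 0 then 1 else 1 / 2)) := by
  apply isProbabilityMeasure_bernoulliLaw <;> split_ifs <;> norm_num

lemma isProbabilityMeasure_flagX (hh : ∀ j, 0 < h j) (j : ℕ) :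
    IsProbabilityMeasure (bernoulliLaw (1 / (h j : ℝ) ^ d)) := by
  have : (1 : ℝ) ≤ h j := by exact_mod_cast hh j
  have := one_le_pow₀ this (n := d)
  exact isProbabilityMeasure_bernoulliLaw (by positivity) (div_le_one_of_le₀ this (by positivity))

namespace IsFlashingFamily

lemma measure_quadruple (hd : 1 ≤ d) (hh : ∀ j, 0 < h j) (hP : IsFlashingFamily h P S X Y R)
    (i : Fin N) (j : ℕ) {s : Set (Lattice d)} {a b : Set Bool} {c : Set ℝ}
    (hc : MeasurableSet c) :
    P {ω | S i (j + 1) ω - S i j ω ∈ s ∧ X i j ω ∈ a ∧ Y i j ω ∈ b ∧ R i j ω ∈ c} =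
      stepLaw d s * (bernoulliLaw (1 / (h j : ℝ) ^ d) a *
        (bernoulliLaw (if j = 0 then 1 else 1 / 2) b * radiusLaw d (h j) c)) := by
  have := isProbabilityMeasure_stepLaw hd
  have := isProbabilityMeasure_flagX (d := d) hh j
  have := isProbabilityMeasure_flagY j
  have := isProbabilityMeasure_radiusLaw hd (hh j)
  rw [← Measure.prod_prod, ← Measure.prod_prod, ← Measure.prod_prod, ← hP.law i j,
    Measure.map_apply]
  · rfl
  · exact ((hP.measurable_walk i (j + 1)).sub (hP.measurable_walk i j)).prodMk
      ((hP.measurable_flagX i j).prodMk ((hP.measurable_flagY i j).prodMk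
        (hP.measurable_radius i j)))
  · exact s.to_countable.measurableSet.prod (a.to_countable.measurableSet.prod
      (b.to_countable.measurableSet.prod hc))

lemma measure_step (hd : 1 ≤ d) (hh : ∀ j, 0 < h j) (hP : IsFlashingFamily h P S X Y R)
    (i : Fin N) (j : ℕ) (s : Set (Lattice d)) :
    P {ω | S i (j + 1) ω - S i j ω ∈ s} = stepLaw d s := by
  have := isProbabilityMeasure_flagX (d := d) hh j
  have := isProbabilityMeasure_flagY j
  have := isProbabilityMeasure_radiusLaw hd (hh j)
  have h1 := hP.measure_quadruple hd hh i j (s := s) (a := Set.univ) (b := Set.univ)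
    MeasurableSet.univ
  simpa only [measure_univ, mul_one, Set.mem_univ, and_true] using h1

lemma ae_isPath (hd : 1 ≤ d) (hh : ∀ j, 0 < h j) (hP : IsFlashingFamily h P S X Y R) (i : Fin N) :
    ∀ᵐ ω ∂P, IsPath fun t => S i t ω := by
  have : ∀ᵐ ω ∂P, ∀ t, ‖toEuclid (S i (t + 1) ω - S i t ω)‖ = 1 := by
    refine ae_all_iff.2 fun t => ?_
    have h1 := hP.measure_step hd hh i t {z | ‖toEuclid z‖ = 1}ᶜ
    rw [show stepLaw d {z | ‖toEuclid z‖ = 1}ᶜ = 0 from ae_stepLaw] at h1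
    exact h1
  filter_upwards [this] with ω hω
  refine ⟨hP.start i ω, fun t => ?_⟩
  rw [Neighbor, norm_sub_rev, ← hω t]
  congr 1
  ext k
  simp [toEuclid]

lemma ae_isUnboundedPath (hd : 1 ≤ d) (hh : ∀ j, 0 < h j) (hP : IsFlashingFamily h P S X Y R)
    (i : Fin N) : ∀ᵐ ω ∂P, IsUnboundedPath fun t => S i t ω := by
  have hind : iIndepFun (fun t ω => S i (t + 1) ω - S i t ω) P :=
    (hP.indep.precomp (Prod.mk_right_injective i)).comp (fun _ q => q.1) fun _ => measurable_fst
  have hblocks : ∀ᵐ ω ∂P, ∀ K ≠ 0, ∃ n, ∀ k < K,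
      S i (n + k + 1) ω - S i (n + k) ω = Pi.single (⟨0, hd⟩ : Fin d) (1 : ℤ) := by
    refine ae_all_iff.2 fun K => ?_
    by_cases hK : K = 0
    · simp [hK]
    have := ae_exists_block
      (fun t => (hP.measurable_walk i (t + 1)).sub (hP.measurable_walk i t)) hind
      (stepLaw_single_ne_zero ⟨0, hd⟩) (fun t => hP.measure_step hd hh i t _) K hK
    filter_upwards [this] with ω hω _
    exact hω
  filter_upwards [hblocks] with ω hω
  exact isUnboundedPath_of_blocks ⟨0, hd⟩ hω

lemma ae_radius_le (hd : 1 ≤ d) (hh : ∀ j, 0 < h j) (hP : IsFlashingFamily h P S X Y R)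
    (i : Fin N) (j : ℕ) : ∀ᵐ ω ∂P, R i j ω ≤ h j := by
  have h1 := hP.measure_quadruple hd hh i j (s := Set.univ) (a := Set.univ) (b := Set.univ)
    (measurableSet_Ioi (a := (h j : ℝ)))
  rw [radiusLaw_Ioi, mul_zero, mul_zero, mul_zero] at h1
  rw [ae_iff]
  simpa using h1

/-- The bound is uniform in `j`. If `h_j ≥ 4`, `Y = 1` has probability at least `1/2` and `R ≤ h_j /
4` has probability `4⁻ᵈ`; if `h_j < 4`, `X = 1` already has probability at least `4⁻ᵈ`. -/
lemma le_measure_goodFlags (hd : 1 ≤ d) (hh : ∀ j, 0 < h j) (hP : IsFlashingFamily h P S X Y R)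
    (i : Fin N) (j : ℕ) : ENNReal.ofReal (1 / 2 * (1 / 4) ^ d) ≤
      P {ω | GoodFlags h j (X i j ω) (Y i j ω) (R i j ω)} := by
  have := isProbabilityMeasure_stepLaw hd
  have := isProbabilityMeasure_flagX (d := d) hh j
  have := isProbabilityMeasure_flagY j
  have := isProbabilityMeasure_radiusLaw hd (hh j)
  have hpos : (0 : ℝ) < h j := by exact_mod_cast hh j
  by_cases h4 : 4 ≤ h j
  · have h1 := hP.measure_quadruple hd hh i j (s := Set.univ) (a := Set.univ) (b := {true})
      (measurableSet_Iic (a := (h j / 4 : ℝ)))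
    rw [bernoulliLaw_true, radiusLaw_Iic hd (by positivity) (by linarith), measure_univ,
      measure_univ, one_mul, one_mul, ← ENNReal.ofReal_mul (by split_ifs <;> norm_num)] at h1
    calc ENNReal.ofReal (1 / 2 * (1 / 4) ^ d)
        ≤ ENNReal.ofReal ((if j = 0 then 1 else 1 / 2) * ((h j / 4 : ℝ) / h j) ^ d) := by
          apply ENNReal.ofReal_le_ofReal
          rw [show (h j / 4 : ℝ) / h j = 1 / 4 by field_simp]
          gcongr
          split_ifs <;> norm_num
      _ ≤ _ := by
          rw [← h1]
          refine measure_mono fun ω hω => Or.inr ⟨?_, h4, ?_⟩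
          · simpa using hω.2.2.1
          · simpa using hω.2.2.2
  · have h1 := hP.measure_quadruple hd hh i j (s := Set.univ) (a := {true}) (b := Set.univ)
      MeasurableSet.univ
    rw [bernoulliLaw_true, measure_univ, measure_univ, measure_univ, one_mul, mul_one, mul_one]
      at h1
    calc ENNReal.ofReal (1 / 2 * (1 / 4) ^ d) ≤ ENNReal.ofReal (1 / (h j : ℝ) ^ d) := by
          apply ENNReal.ofReal_le_ofReal
          have h4' : (h j : ℝ) ≤ 4 := by exact_mod_cast (not_le.1 h4).le
          calc (1 / 2 * (1 / 4) ^ d : ℝ) ≤ 1 * (1 / 4) ^ d := by gcongr; norm_num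
            _ = 1 / 4 ^ d := by rw [one_mul, one_div_pow]
            _ ≤ _ := by gcongr
      _ ≤ _ := by
          rw [← h1]
          refine measure_mono fun ω hω => Or.inl ?_
          simpa using hω.2.1

lemma ae_frequently_goodFlags (hd : 1 ≤ d) (hh : ∀ j, 0 < h j)
    (hP : IsFlashingFamily h P S X Y R) (i : Fin N) :
    ∀ᵐ ω ∂P, ∃ᶠ j in Filter.atTop, GoodFlags h j (X i j ω) (Y i j ω) (R i j ω) := by
  have := hP.indep.isProbabilityMeasure
  let B : ℕ → Set Ω := fun j => {ω | GoodFlags h j (X i j ω) (Y i j ω) (R i j ω)}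
  have hG : ∀ j, MeasurableSet {q : Lattice d × Bool × Bool × ℝ |
      GoodFlags h j q.2.1 q.2.2.1 q.2.2.2} := by
    intro j
    unfold GoodFlags
    refine measurableSet_setOfPred.2 (Measurable.or ?_ (Measurable.and ?_
      (measurable_const.and ?_)))
    · exact measurableSet_setOfPred.1 (measurableSet_eq_fun (by fun_prop) (by fun_prop))
    · exact measurableSet_setOfPred.1 (measurableSet_eq_fun (by fun_prop) (by fun_prop))
    · exact measurableSet_setOfPred.1 (measurableSet_le (by fun_prop) (by fun_prop))
  have hBm : ∀ j, MeasurableSet (B j) := fun j =>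
    (((hP.measurable_walk i (j + 1)).sub (hP.measurable_walk i j)).prodMk
      ((hP.measurable_flagX i j).prodMk ((hP.measurable_flagY i j).prodMk
        (hP.measurable_radius i j)))) (hG j)
  have hB : iIndepSet B P := (iIndepSet_iff_meas_biInter hBm).2 fun s =>
    (hP.indep.precomp (Prod.mk_right_injective i)).meas_biInter fun j _ => ⟨_, hG j, rfl⟩
  have hlim := measure_limsup_eq_one hBm hB (by
    refine top_unique ?_
    rw [← ENNReal.tsum_const_eq_top_of_ne_zero (α := ℕ)
      (c := ENNReal.ofReal (1 / 2 * (1 / 4) ^ d)) (by simp)]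
    exact ENNReal.tsum_le_tsum fun j => hP.le_measure_goodFlags hd hh i j)
  have hae : ∀ᵐ ω ∂P, ω ∈ Filter.limsup B Filter.atTop :=
    (mem_ae_iff_prob_eq_one (MeasurableSet.measurableSet_limsup hBm)).2 hlim
  filter_upwards [hae] with ω hω
  exact Filter.mem_limsup_iff_frequently_mem.1 hω

/-- Almost surely, all the explorers settle. -/
theorem ae_flashTime_ne_top (hd : 1 ≤ d) (hh : ∀ j, 0 < h j) (hP : IsFlashingFamily h P S X Y R) :
    ∀ᵐ ω ∂P, ∀ i, flashTime h (fun i t => S i t ω) (fun i j => X i j ω)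
      (fun i j => Y i j ω) (fun i j => R i j ω) i ≠ ⊤ := by
  refine ae_all_iff.2 fun i => ?_
  filter_upwards [hP.ae_isPath hd hh i, hP.ae_isUnboundedPath hd hh i,
    hP.ae_frequently_goodFlags hd hh i] with ω h1 h2 h3
  exact flashTime_ne_top hh h1 h2 h3

end IsFlashingFamily

end AlmostSure

/-! ### The coupling -/

section Coupling

variable {d N : ℕ} {h : ℕ → ℕ}

/-- The flags and radii of the explorers. -/
abbrev Flags (N : ℕ) : Type := Fin N × ℕ → Bool × Bool × ℝ

/-- The law of the flags and radius of one explorer in the shell `S_j`. -/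
noncomputable def flagLaw (d : ℕ) (h : ℕ → ℕ) (j : ℕ) : Measure (Bool × Bool × ℝ) :=
  (bernoulliLaw (1 / (h j : ℝ) ^ d)).prod
    ((bernoulliLaw (if j = 0 then 1 else 1 / 2)).prod (radiusLaw d (h j)))

lemma isProbabilityMeasure_flagLaw (hd : 1 ≤ d) (hh : ∀ j, 0 < h j) (j : ℕ) :
    IsProbabilityMeasure (flagLaw d h j) := by
  have := isProbabilityMeasure_flagX (d := d) hh j
  have := isProbabilityMeasure_flagY j
  have := isProbabilityMeasure_radiusLaw hd (hh j)
  unfold flagLaw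
  infer_instance

/-- The flashing times of the explorers. -/
def envFlash (h : ℕ → ℕ) (ω : Env (Flags N) d N) (i : Fin N) (t : ℕ) : Prop :=
  IsFlash h (fun j => (ω.1 (i, j)).1) (fun j => (ω.1 (i, j)).2.1) (fun j => (ω.1 (i, j)).2.2)
    (walk (explorerStep ω) i) t

lemma isAdapted_envFlash : IsAdapted (envFlash h : Env (Flags N) d N → Fin N → ℕ → Prop) where
  congr _ _ _ _ _ hs := isFlash_congr hs
  measurableSet i t := measurableSet_setOfPred.2 (measurable_isFlash
    (S := fun t ω => walk (explorerStep ω) i t) (measurable_walk i)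
    (x := fun j (ω : Env (Flags N) d N) => (ω.1 (i, j)).1) (by fun_prop)
    (y := fun j (ω : Env (Flags N) d N) => (ω.1 (i, j)).2.1) (by fun_prop)
    (ρ := fun j (ω : Env (Flags N) d N) => (ω.1 (i, j)).2.2) (by fun_prop) t)

lemma isFlashingFamily_env [∀ j, IsProbabilityMeasure (flagLaw d h j)]
    [IsProbabilityMeasure (stepLaw d)] :
    IsFlashingFamily h ((Measure.infinitePi fun p : Fin N × ℕ => flagLaw d h p.2).prod
        (Measure.infinitePi fun _ : (Fin N × ℕ) ⊕ (Fin N × ℕ) => stepLaw d))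
      (fun i t (ω : Env (Flags N) d N) => walk (explorerStep ω) i t) (fun i j ω => (ω.1 (i, j)).1)
      (fun i j ω => (ω.1 (i, j)).2.1) (fun i j ω => (ω.1 (i, j)).2.2) := by
  set P := (Measure.infinitePi fun p : Fin N × ℕ => flagLaw d h p.2).prod
        (Measure.infinitePi fun _ : (Fin N × ℕ) ⊕ (Fin N × ℕ) => stepLaw d) with hPdef
  have hZm : ∀ p : Fin N × ℕ, Measurable fun ω : Env (Flags N) d N => (explorerStep ω p, ω.1 p) :=
    fun p => (measurable_explorerStep p).prodMk (by fun_prop)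
  have hmp : MeasurePreserving (Prod.map id
      (fun (u : (Fin N × ℕ) ⊕ (Fin N × ℕ) → Lattice d) (p : Fin N × ℕ) => u (Sum.inl p))) P
      ((Measure.infinitePi fun p : Fin N × ℕ => flagLaw d h p.2).prod
        (Measure.infinitePi fun _ : Fin N × ℕ => stepLaw d)) :=
    (MeasurePreserving.id _).prod ⟨by fun_prop,
      Measure.map_infinitePi_infinitePi_of_inj (P := fun _ => stepLaw d) Sum.inl_injective⟩
  have hjoint : P.map (fun (ω : Env (Flags N) d N) p => (explorerStep ω p, ω.1 p)) =
      Measure.infinitePi fun p : Fin N × ℕ => (stepLaw d).prod (flagLaw d h p.2) := by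
    rw [← map_pair_infinitePi, ← Measure.prod_swap, ← hmp.map_eq,
      Measure.map_map (by fun_prop) (by fun_prop), Measure.map_map (by fun_prop) (by fun_prop)]
    rfl
  have hlaw : ∀ p, P.map (fun ω : Env (Flags N) d N => (explorerStep ω p, ω.1 p)) =
      (stepLaw d).prod (flagLaw d h p.2) := by
    intro p
    rw [← Measure.infinitePi_map_eval
      (fun p : Fin N × ℕ => (stepLaw d).prod (flagLaw d h p.2)) p, ← hjoint,
      Measure.map_map (measurable_pi_apply p) (measurable_pi_iff.2 hZm)]
    rfl
  refine ⟨measurable_walk, fun i j => by fun_prop, fun i j => by fun_prop, fun i j => by fun_prop,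
    fun i ω => walk_zero _ i, ?_, ?_⟩
  · simp only [walk_succ, add_sub_cancel_left]
    refine (iIndepFun_iff_map_fun_eq_infinitePi_map hZm).2 ?_
    rw [hjoint]
    simp only [hlaw]
  · intro i j
    simp only [walk_succ, add_sub_cancel_left]
    exact hlaw (i, j)

lemma isWalkFamily_env (ν : Measure (Flags N)) [IsProbabilityMeasure ν]
    [IsProbabilityMeasure (stepLaw d)] {F : Env (Flags N) d N → Fin N → ℕ → Prop}
    (hF : IsAdapted F) :
    IsWalkFamily (ν.prod (Measure.infinitePi fun _ : (Fin N × ℕ) ⊕ (Fin N × ℕ) => stepLaw d))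
      (fun i t ω => walk (envFinalOutput F ω) i t) := by
  have hm := measurable_pi_iff.1 (measurable_envFinalOutput hF)
  have hjoint := map_envFinalOutput ν (stepLaw d) hF
  have hlaw : ∀ p, (ν.prod (Measure.infinitePi
      fun _ : (Fin N × ℕ) ⊕ (Fin N × ℕ) => stepLaw d)).map (fun ω => envFinalOutput F ω p) =
      stepLaw d := by
    intro p
    have h1 := congrArg (Measure.map fun u : Fin N × ℕ → Lattice d => u p) hjoint
    rwa [Measure.map_map (measurable_pi_apply p) (measurable_envFinalOutput hF),
      Measure.infinitePi_map_eval] at h1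
  refine ⟨fun i t => Finset.measurable_sum _ fun s _ => hm (i, s), fun i ω => walk_zero _ i, ?_, ?_⟩
  · simp only [walk_succ, add_sub_cancel_left]
    refine (iIndepFun_iff_map_fun_eq_infinitePi_map hm).2 ?_
    simp only [hlaw]
    exact hjoint
  · intro i t
    simp only [walk_succ, add_sub_cancel_left]
    exact hlaw (i, t)

lemma measurable_finalTime {F : Env (Flags N) d N → Fin N → ℕ → Prop} (hF : IsAdapted F)
    (i : Fin N) : Measurable fun ω => finalTime (walk (explorerStep ω)) (F ω) i :=
  Measurable.iSup fun m => (measurable_pi_apply i).comp (measurable_run hF m).snd.snd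

end Coupling

end FlashingDLA

theorem mainTheorem5 (d : ℕ) (hd : 1 ≤ d) (N : ℕ) (h : ℕ → ℕ) (hh : ∀ j, 0 < h j) :
    ∃ (Ω : Type) (_ : MeasurableSpace Ω) (P : Measure Ω) (_ : IsProbabilityMeasure P)
      (W S : Fin N → ℕ → Ω → Lattice d) (X Y : Fin N → ℕ → Ω → Bool)
      (R : Fin N → ℕ → Ω → ℝ) (T Tstar : Fin N → Ω → ℕ) (A Astar : Ω → Set (Lattice d)),
      -- `A` is the internal DLA cluster `A(N)` of the independent walks `W`
      IsWalkFamily P W ∧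
      (∀ ω, A ω = idlaCluster (fun i t => W i t ω) N) ∧
      -- `Astar` is the flashing cluster `A*(N)` of the walks `S` with flags `X`, `Y`, radii `R`
      IsFlashingFamily h P S X Y R ∧
      (∀ ω, Astar ω = flashCluster h (fun i t => S i t ω) (fun i j => X i j ω)
        (fun i j => Y i j ω) (fun i j => R i j ω) N) ∧
      (∀ i, Measurable (T i)) ∧ (∀ i, Measurable (Tstar i)) ∧
      ∀ᵐ ω ∂P,
        -- the features of the coupling
        A ω = ⋃ i, {S i (T i ω) ω} ∧
        Astar ω = ⋃ i, {S i (Tstar i ω) ω} ∧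
        (∀ i, flashTime h (fun i t => S i t ω) (fun i j => X i j ω)
          (fun i j => Y i j ω) (fun i j => R i j ω) i = (Tstar i ω : ℕ∞)) ∧
        (∀ i, T i ω ≤ Tstar i ω) ∧
        -- the comparison of the two clusters
        ∀ k : ℕ, 1 ≤ k →
          (Astar ω ⊆ (⋃ j < k, shell d h j) → A ω ⊆ (⋃ j < k, shell d h j)) ∧
          ((⋃ j < k, shell d h j) ⊆ Astar ω → (⋃ j < k, shell d h j) ⊆ A ω) := by
  have := isProbabilityMeasure_stepLaw hd
  have := isProbabilityMeasure_flagLaw hd hh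
  have hfam := isFlashingFamily_env (d := d) (N := N) (h := h)
  refine ⟨Env (Flags N) d N, inferInstance,
    (Measure.infinitePi fun p : Fin N × ℕ => flagLaw d h p.2).prod
      (Measure.infinitePi fun _ => stepLaw d), inferInstance,
    fun i t ω => walk (envFinalOutput (envFlash h) ω) i t,
    fun i t ω => walk (explorerStep ω) i t, fun i j ω => (ω.1 (i, j)).1,
    fun i j ω => (ω.1 (i, j)).2.1, fun i j ω => (ω.1 (i, j)).2.2,
    fun i ω => finalTime (walk (explorerStep ω)) (envFlash h ω) i,
    fun i ω => (flashTime h (fun i t => walk (explorerStep ω) i t) (fun i j => (ω.1 (i, j)).1)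
      (fun i j => (ω.1 (i, j)).2.1) (fun i j => (ω.1 (i, j)).2.2) i).toNat,
    _, _, isWalkFamily_env _ isAdapted_envFlash, fun ω => rfl, hfam, fun ω => rfl,
    measurable_finalTime isAdapted_envFlash,
    measurable_flashTime_toNat hfam.measurable_walk hfam.measurable_flagX hfam.measurable_flagY
      hfam.measurable_radius, ?_⟩
  filter_upwards [hfam.ae_flashTime_ne_top hd hh, ae_all_iff.2 fun i => hfam.ae_isPath hd hh i,
    ae_all_iff.2 fun i => ae_all_iff.2 fun j => hfam.ae_radius_le hd hh i j] with ω htop hpath hrad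
  -- On this almost sure event settling times are finite, so `toNat` loses nothing.
  have hT := fun i => (ENat.natCast_toNat (htop i)).symm
  obtain ⟨hle, hinj, hrange⟩ := finalTime_spec (ξ := explorerStep ω) (F := envFlash h ω)
    (W := walk (envFinalOutput (envFlash h) ω)) (fun i => isFlash_of_flashTime_eq (hT i))
    (fun i j hij t ht hf => flashTime_priority hT hij ht hf) (walk_zero _)
    (fun m a b hq => by rw [walk_succ, envFinalOutput, finalOutput_of_query hq])
  have hA : idlaCluster (fun i t => walk (envFinalOutput (envFlash h) ω) i t) N =
      ⋃ i, {walk (explorerStep ω) i (finalTime (walk (explorerStep ω)) (envFlash h ω) i)} := by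
    rw [Set.iUnion_singleton_eq_range]
    exact hrange.symm
  have hAstar := flashCluster_eq_iUnion hT
  refine ⟨hA, hAstar, hT, hle, fun k _ => ?_⟩
  rw [hA, hAstar]
  exact shells_comparison hh hrad hpath hT hle hinj k
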